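/- **Left and right adequate monoids.** On a monoid $M$ define $a\,\mathcal R^*\,b$ iff ($xa=ya \Leftrightarrow xb=yb$ for all $x,y\in M$), and $a\,\mathcal L^*\,b$ iff ($ax=ay\Leftrightarrow bx=by$ for all $x,y\in M$). $M$ is *left* [*right*] *adequate* if its idempotents commute and every $\mathcal R^*$-class [$\mathcal L^*$-class] contains an idempotent, which is then unique; the idempotent in the class of $x$ is denoted $x^+$ [$x^*$]. Left [right] adequate monoids are regarded as $(2,1,0)$-algebras with operations multiplication, $x\mapsto x^+$ [$x\mapsto x^*$] and the constant $1$; morphisms are the maps preserving all three. **Trees.** Let $\Sigma$ be a set. A *$\Sigma$-tree* is a finite directed graph with edges labelled by elements of $\Sigma$, whose underlying undirected (multi)graph is a tree, with a start vertex and an end vertex such that there is a (possibly empty) directed path from the start vertex to the end vertex. It is *left* [*right*] *adequate* if for every vertex $v$ there is a directed path from the start vertex to $v$ [from $v$ to the end vertex]. A *morphism* of $\Sigma$-trees maps vertices to vertices and edges to edges, preserving sources, targets, labels, the start vertex and the end vertex; an *isomorphism* is a morphism bijective on vertices and on edges. A *retraction* of $X$ is an idempotent morphism $X\to X$, and its image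 is a *retract* of $X$; $X$ is *pruned* if its only retraction is the identity. Every $\Sigma$-tree $X$ has a pruned retract $\overline X$, unique up to isomorphism. $X\times Y$ is obtained from disjoint copies of $X$ and $Y$ by identifying the end vertex of $X$ with the start vertex of $Y$; it has the start vertex of $X$ and the end vertex of $Y$. $X^{(+)}$ is $X$ with its end vertex moved to its start vertex, and $X^{(*)}$ is $X$ with its start vertex moved to its end vertex. The *trivial tree* has one vertex and no edges. The *base tree* of $a\in\Sigma$ has a single edge, labelled $a$, from its start vertex to its (distinct) end vertex. Let $LT^1(\Sigma)$ [$RT^1(\Sigma)$] be the set of isomorphism types of pruned left [right] adequate $\Sigma$-trees, as a $(2,1,0)$-algebra with multiplication $XY=\overline{X\times Y}$, unary operation $X^+=\overline{X^{(+)}}$ [$X^*=\overline{X^{(*)}}$], and the trivial tree as distinguished constant. **Theorem.** For every set $\Sigma$, the algebra $LT^1(\Sigma)$ is a left adequate monoid, distinct letters have distinct base trees, and $LT^1(\Sigma)$ is freely generated by the set of base trees in the class of left adequate monoids: for every left adequate monoid $M$, every function from the set of base trees to $M$ extends to a unique $(2,1,0)$-morphism $LT^1(\Sigma)\to M$. Dually,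 $RT^1(\Sigma)$ is a right adequate monoid, distinct letters have distinct base trees, and $RT^1(\Sigma)$ is freely generated by the set of base trees in the class of right adequate monoids. -/

import Mathlib

universe u v w

namespace AdequateTrees

/-! ### Algebras of signature (2,1,0); left and right adequate monoids -/

/-- An algebra of signature `(2,1,0)`: a binary operation, a distinguished constant and a unary
operation `un`. No laws are imposed. -/
class Alg210 (M : Type u) extends Mul M, One M where
  un : M → M

/-- Morphisms of `(2,1,0)`-algebras. -/
structure IsMorphism {F : Type u} {M : Type v} [Alg210 F] [Alg210 M] (f : F → M) : Prop where
  map_mul : ∀ x y, f (x * y) = f x * f y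
  map_one : f 1 = 1
  map_un : ∀ x, f (Alg210.un x) = Alg210.un (f x)

/-- The relation `R*` on a monoid: `xa = ya ↔ xb = yb` for all `x, y`. -/
def RStar {M : Type u} [Mul M] (a b : M) : Prop := ∀ x y : M, x * a = y * a ↔ x * b = y * b

/-- The relation `L*` on a monoid: `ax = ay ↔ bx = by` for all `x, y`. -/
def LStar {M : Type u} [Mul M] (a b : M) : Prop := ∀ x y : M, a * x = a * y ↔ b * x = b * y

/-- The laws of a monoid. -/
structure IsMonoid (M : Type u) [Alg210 M] : Prop where
  mul_assoc : ∀ x y z : M, x * y * z = x * (y * z)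
  one_mul : ∀ x : M, 1 * x = x
  mul_one : ∀ x : M, x * 1 = x

/-- A left adequate monoid: a monoid in which idempotents commute and each `R*`-class contains
an idempotent, as a `(2,1,0)`-algebra whose unary operation `x ↦ x⁺` sends `x` to the
(then unique) idempotent in its `R*`-class. -/
structure IsLeftAdequateMonoid (M : Type u) [Alg210 M] : Prop extends IsMonoid M where
  idem_comm : ∀ e f : M, IsIdempotentElem e → IsIdempotentElem f → e * f = f * e
  un_idem : ∀ x : M, IsIdempotentElem (Alg210.un x)
  un_rel : ∀ x : M, RStar x (Alg210.un x)

/-- A right adequate monoid: a monoid in which idempotents commute and each `L*`-class contains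
an idempotent, as a `(2,1,0)`-algebra whose unary operation `x ↦ x*` sends `x` to the
(then unique) idempotent in its `L*`-class. -/
structure IsRightAdequateMonoid (M : Type u) [Alg210 M] : Prop extends IsMonoid M where
  idem_comm : ∀ e f : M, IsIdempotentElem e → IsIdempotentElem f → e * f = f * e
  un_idem : ∀ x : M, IsIdempotentElem (Alg210.un x)
  un_rel : ∀ x : M, LStar x (Alg210.un x)

/-- `F` is a left adequate monoid, and it is free on the subset `S` among the left adequate
monoids with carrier in the universe `w`. -/
structure IsFreeLeftAdequateMonoidOn (F : Type u) [Alg210 F] (S : Set F) : Prop where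
  mem : IsLeftAdequateMonoid F
  exists_unique_extension : ∀ (M : Type w) [Alg210 M], IsLeftAdequateMonoid M →
    ∀ χ : S → M, ∃! f : F → M, IsMorphism f ∧ ∀ s : S, f s = χ s

/-- `F` is a right adequate monoid, and it is free on the subset `S` among the right adequate
monoids with carrier in the universe `w`. -/
structure IsFreeRightAdequateMonoidOn (F : Type u) [Alg210 F] (S : Set F) : Prop where
  mem : IsRightAdequateMonoid F
  exists_unique_extension : ∀ (M : Type w) [Alg210 M], IsRightAdequateMonoid M →
    ∀ χ : S → M, ∃! f : F → M, IsMorphism f ∧ ∀ s : S, f s = χ s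

/-! ### Labelled directed trees -/

/-- A directed graph (loops and multiple edges allowed) with edges labelled by `A`. -/
structure LDigraph (A : Type u) where
  V : Type
  E : Type
  src : E → V
  tgt : E → V
  label : E → A

namespace LDigraph

variable {A : Type u}

/-- There is an edge from `x` to `y`. -/
def Step (D : LDigraph A) (x y : D.V) : Prop := ∃ e, D.src e = x ∧ D.tgt e = y

/-- There is a (possibly empty) directed path from `x` to `y`. -/
def Reach (D : LDigraph A) : D.V → D.V → Prop := Relation.ReflTransGen D.Step

/-- The underlying simple graph. -/
def underlying (D : LDigraph A) : SimpleGraph D.V := SimpleGraph.fromRel D.Step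

/-- The underlying undirected (multi)graph is a tree. -/
structure IsTree (D : LDigraph A) : Prop where
  no_loop : ∀ e, D.src e ≠ D.tgt e
  no_multi : ∀ e f, s(D.src e, D.tgt e) = s(D.src f, D.tgt f) → e = f
  tree : D.underlying.IsTree

theorem adj_iff {D : LDigraph A} {x y : D.V} :
    D.underlying.Adj x y ↔ x ≠ y ∧ (D.Step x y ∨ D.Step y x) := SimpleGraph.fromRel_adj _ _ _

theorem IsTree.adj {D : LDigraph A} (h : D.IsTree) (e : D.E) :
    D.underlying.Adj (D.src e) (D.tgt e) := adj_iff.2 ⟨h.no_loop e, Or.inl ⟨e, rfl, rfl⟩⟩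

theorem card_edgeSet {D : LDigraph A} (h1 : ∀ e, D.src e ≠ D.tgt e)
    (h2 : ∀ e f, s(D.src e, D.tgt e) = s(D.src f, D.tgt f) → e = f) :
    Nat.card D.underlying.edgeSet = Nat.card D.E := by
  symm
  refine Nat.card_congr (Equiv.ofBijective (fun e => ⟨s(D.src e, D.tgt e), ?_⟩) ⟨?_, ?_⟩)
  · rw [SimpleGraph.mem_edgeSet, adj_iff]
    exact ⟨h1 e, Or.inl ⟨e, rfl, rfl⟩⟩
  · intro e f h
    exact h2 e f (congrArg Subtype.val h)
  · rintro ⟨x, hx⟩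
    induction x with
    | _ x y =>
      rw [SimpleGraph.mem_edgeSet, adj_iff] at hx
      obtain ⟨-, ⟨e, rfl, rfl⟩ | ⟨e, rfl, rfl⟩⟩ := hx
      · exact ⟨e, rfl⟩
      · exact ⟨e, Subtype.ext Sym2.eq_swap⟩

end LDigraph

/-- A `Σ`-tree over the alphabet `A`: a finite edge-labelled directed tree with a start and an end
vertex (`start`, `finish`) such that there is a directed path from start to end. -/
structure SigmaTree (A : Type u) extends LDigraph A where
  finV : Finite V
  finE : Finite E
  isTree : toLDigraph.IsTree
  start : V
  finish : V
  path : toLDigraph.Reach start finish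

namespace SigmaTree

variable {A : Type u}

instance (X : SigmaTree A) : Finite X.V := X.finV
instance (X : SigmaTree A) : Finite X.E := X.finE

/-- Morphisms of `Σ`-trees. -/
@[ext]
structure Hom (X Y : SigmaTree A) where
  vmap : X.V → Y.V
  emap : X.E → Y.E
  src_emap : ∀ e, Y.src (emap e) = vmap (X.src e)
  tgt_emap : ∀ e, Y.tgt (emap e) = vmap (X.tgt e)
  label_emap : ∀ e, Y.label (emap e) = X.label e
  map_start : vmap X.start = Y.start
  map_finish : vmap X.finish = Y.finish

namespace Hom

/-- The identity morphism. -/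
def id (X : SigmaTree A) : Hom X X :=
  ⟨fun x => x, fun e => e, fun _ => rfl, fun _ => rfl, fun _ => rfl, rfl, rfl⟩

/-- Composition of morphisms: `g.comp f` is `f` followed by `g`. -/
def comp {X Y Z : SigmaTree A} (g : Hom Y Z) (f : Hom X Y) : Hom X Z where
  vmap := g.vmap ∘ f.vmap
  emap := g.emap ∘ f.emap
  src_emap e := by simp [g.src_emap, f.src_emap]
  tgt_emap e := by simp [g.tgt_emap, f.tgt_emap]
  label_emap e := by simp [g.label_emap, f.label_emap]
  map_start := by simp [f.map_start, g.map_start]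
  map_finish := by simp [f.map_finish, g.map_finish]

/-- A morphism is an isomorphism if it is bijective on vertices and on edges. -/
def IsIso {X Y : SigmaTree A} (f : Hom X Y) : Prop :=
  Function.Bijective f.vmap ∧ Function.Bijective f.emap

theorem comp_assoc {X Y Z W : SigmaTree A} (h : Hom Z W) (g : Hom Y Z) (f : Hom X Y) :
    (h.comp g).comp f = h.comp (g.comp f) := rfl

theorem id_comp {X Y : SigmaTree A} (f : Hom X Y) : (id Y).comp f = f := rfl

theorem comp_id {X Y : SigmaTree A} (f : Hom X Y) : f.comp (id X) = f := rfl

theorem IsIso.exists_inv {X Y : SigmaTree A} {f : Hom X Y} (h : f.IsIso) :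
    ∃ g : Hom Y X, g.comp f = id X ∧ f.comp g = id Y := by
  obtain ⟨gv, hv1, hv2⟩ := Function.bijective_iff_has_inverse.1 h.1
  obtain ⟨ge, he1, he2⟩ := Function.bijective_iff_has_inverse.1 h.2
  refine ⟨⟨gv, ge, fun e => ?_, fun e => ?_, fun e => ?_, ?_, ?_⟩, ?_, ?_⟩
  · apply h.1.1; rw [hv2, ← f.src_emap, he2]
  · apply h.1.1; rw [hv2, ← f.tgt_emap, he2]
  · rw [← f.label_emap, he2]
  · rw [← f.map_start, hv1]
  · rw [← f.map_finish, hv1]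
  · exact Hom.ext (funext hv1) (funext he1)
  · exact Hom.ext (funext hv2) (funext he2)

theorem isIso_of_inv {X Y : SigmaTree A} {f : Hom X Y} {g : Hom Y X}
    (h1 : g.comp f = id X) (h2 : f.comp g = id Y) : f.IsIso :=
  ⟨Function.bijective_iff_has_inverse.2 ⟨g.vmap, congrFun (congrArg vmap h1),
    congrFun (congrArg vmap h2)⟩, Function.bijective_iff_has_inverse.2
    ⟨g.emap, congrFun (congrArg emap h1), congrFun (congrArg emap h2)⟩⟩

theorem step {X Y : SigmaTree A} (f : Hom X Y) {x y : X.V} (h : X.Step x y) :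
    Y.Step (f.vmap x) (f.vmap y) := by
  obtain ⟨e, rfl, rfl⟩ := h
  exact ⟨f.emap e, f.src_emap e, f.tgt_emap e⟩

theorem reach {X Y : SigmaTree A} (f : Hom X Y) {x y : X.V} (h : X.Reach x y) :
    Y.Reach (f.vmap x) (f.vmap y) := Relation.ReflTransGen.lift f.vmap (fun _ _ => f.step) _ _ h

end Hom

/-- Isomorphism of `Σ`-trees. -/
def Iso (X Y : SigmaTree A) : Prop := ∃ f : Hom X Y, f.IsIso

theorem Iso.refl (X : SigmaTree A) : Iso X X :=
  ⟨Hom.id X, Function.bijective_id, Function.bijective_id⟩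

theorem Iso.symm {X Y : SigmaTree A} (h : Iso X Y) : Iso Y X := by
  obtain ⟨f, hf⟩ := h
  obtain ⟨g, h1, h2⟩ := hf.exists_inv
  exact ⟨g, Hom.isIso_of_inv h2 h1⟩

theorem Iso.trans {X Y Z : SigmaTree A} (h : Iso X Y) (h' : Iso Y Z) : Iso X Z := by
  obtain ⟨f, hf⟩ := h
  obtain ⟨g, hg⟩ := h'
  exact ⟨g.comp f, hg.1.comp hf.1, hg.2.comp hf.2⟩

instance isoSetoid (A : Type u) : Setoid (SigmaTree A) :=
  ⟨Iso, Iso.refl, Iso.symm, Iso.trans⟩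

/-! ### Left and right adequate trees, the trivial tree and base trees -/

/-- There is a directed path from the start vertex to each vertex. -/
def IsLeftAdequate (X : SigmaTree A) : Prop := ∀ x : X.V, X.Reach X.start x

/-- There is a directed path from each vertex to the end vertex. -/
def IsRightAdequate (X : SigmaTree A) : Prop := ∀ x : X.V, X.Reach x X.finish

/-- The trivial tree: one vertex, no edges. -/
def trivial (A : Type u) : SigmaTree A where
  V := Unit
  E := Empty
  src := Empty.elim
  tgt := Empty.elim
  label := Empty.elim
  finV := inferInstance
  finE := inferInstance
  isTree := ⟨fun e => e.elim, fun e => e.elim, SimpleGraph.IsTree.of_subsingleton⟩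
  start := ()
  finish := ()
  path := Relation.ReflTransGen.refl

/-- The base tree of a letter `a`: a single edge, labelled `a`, from the start vertex (`false`) to
the end vertex (`true`). -/
def base (a : A) : SigmaTree A where
  V := Bool
  E := Unit
  src _ := false
  tgt _ := true
  label _ := a
  finV := inferInstance
  finE := inferInstance
  isTree := by
    have h1 : ∀ e : Unit, false ≠ true := by simp
    have h2 : ∀ e f : Unit, s(false, true) = s(false, true) → e = f := fun _ _ _ => rfl
    refine ⟨h1, h2, SimpleGraph.isTree_iff_connected_and_card.2 ⟨?_, ?_⟩⟩
    · have : Nonempty (LDigraph.mk Bool Unit (fun _ => false) (fun _ => true) fun _ => a).V :=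
        ⟨false⟩
      refine ⟨fun x y => ?_⟩
      by_cases h : x = y
      · subst h; exact SimpleGraph.Reachable.refl _
      · refine SimpleGraph.Adj.reachable (LDigraph.adj_iff.2 ⟨h, ?_⟩)
        rcases x with _ | _ <;> rcases y with _ | _
        · exact absurd rfl h
        · exact Or.inl ⟨(), rfl, rfl⟩
        · exact Or.inr ⟨(), rfl, rfl⟩
        · exact absurd rfl h
    · rw [LDigraph.card_edgeSet h1 h2]
      simp
  start := false
  finish := true
  path := Relation.ReflTransGen.single ⟨(), rfl, rfl⟩

/-! ### Unpruned operations -/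

/-- Unpruned `(+)`: the end vertex is moved to the start vertex. -/
def uplus (X : SigmaTree A) : SigmaTree A :=
  { X with finish := X.start, path := Relation.ReflTransGen.refl }

/-- Unpruned `(*)`: the start vertex is moved to the end vertex. -/
def ustar (X : SigmaTree A) : SigmaTree A :=
  { X with start := X.finish, path := Relation.ReflTransGen.refl }

/-- The vertices of `Y` inside `X × Y`: the start vertex of `Y` is the end vertex of `X`, the other
vertices of `Y` are new. -/
noncomputable def glue (X Y : SigmaTree A) (y : Y.V) : X.V ⊕ {y : Y.V // y ≠ Y.start} :=
  open Classical in if h : y = Y.start then Sum.inl X.finish else Sum.inr ⟨y, h⟩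

theorem glue_start (X Y : SigmaTree A) : glue X Y Y.start = Sum.inl X.finish := dif_pos rfl

theorem glue_of_ne (X Y : SigmaTree A) {y : Y.V} (h : y ≠ Y.start) :
    glue X Y y = Sum.inr ⟨y, h⟩ := dif_neg h

theorem glue_injective (X Y : SigmaTree A) : Function.Injective (glue X Y) := by
  intro y z h
  by_cases hy : y = Y.start <;> by_cases hz : z = Y.start
  · rw [hy, hz]
  · rw [hy, glue_start, glue_of_ne X Y hz] at h; cases h
  · rw [hz, glue_start, glue_of_ne X Y hy] at h; cases h
  · rw [glue_of_ne X Y hy, glue_of_ne X Y hz] at h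
    exact congrArg Subtype.val (Sum.inr_injective h)

theorem eq_start_of_glue_eq_inl {X Y : SigmaTree A} {y : Y.V} {x : X.V}
    (h : glue X Y y = Sum.inl x) : y = Y.start := by
  by_contra hy
  rw [glue_of_ne X Y hy] at h
  cases h

/-- The labelled graph of `X × Y`. -/
noncomputable def gluedGraph (X Y : SigmaTree A) : LDigraph A where
  V := X.V ⊕ {y : Y.V // y ≠ Y.start}
  E := X.E ⊕ Y.E
  src := Sum.elim (fun e => Sum.inl (X.src e)) (fun e => glue X Y (Y.src e))
  tgt := Sum.elim (fun e => Sum.inl (X.tgt e)) (fun e => glue X Y (Y.tgt e))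
  label := Sum.elim X.label Y.label

theorem gluedGraph_reach_left (X Y : SigmaTree A) {x x' : X.V} (h : X.Reach x x') :
    (gluedGraph X Y).Reach (Sum.inl x) (Sum.inl x') := by
  refine Relation.ReflTransGen.lift (p := (gluedGraph X Y).Step) Sum.inl ?_ _ _ h
  rintro _ _ ⟨e, rfl, rfl⟩
  exact ⟨Sum.inl e, rfl, rfl⟩

theorem gluedGraph_reach_right (X Y : SigmaTree A) {y y' : Y.V} (h : Y.Reach y y') :
    (gluedGraph X Y).Reach (glue X Y y) (glue X Y y') := by
  refine Relation.ReflTransGen.lift (p := (gluedGraph X Y).Step) (glue X Y) ?_ _ _ h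
  rintro _ _ ⟨e, rfl, rfl⟩
  exact ⟨Sum.inr e, rfl, rfl⟩

theorem gluedGraph_isTree (X Y : SigmaTree A) : (gluedGraph X Y).IsTree := by
  have h1 : ∀ e, (gluedGraph X Y).src e ≠ (gluedGraph X Y).tgt e := by
    rintro (e | e) h
    · exact X.isTree.no_loop e (Sum.inl_injective h)
    · exact Y.isTree.no_loop e (glue_injective X Y h)
  have key : ∀ (e : X.E) (f : Y.E),
      s((Sum.inl (X.src e) : X.V ⊕ {y : Y.V // y ≠ Y.start}), Sum.inl (X.tgt e)) ≠
        s(glue X Y (Y.src f), glue X Y (Y.tgt f)) := by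
    intro e f h
    apply Y.isTree.no_loop f
    rcases Sym2.eq_iff.1 h with ⟨ha, hb⟩ | ⟨ha, hb⟩ <;>
      rw [eq_start_of_glue_eq_inl ha.symm, eq_start_of_glue_eq_inl hb.symm]
  have h2 : ∀ e f, s((gluedGraph X Y).src e, (gluedGraph X Y).tgt e) =
      s((gluedGraph X Y).src f, (gluedGraph X Y).tgt f) → e = f := by
    rintro (e | e) (f | f) h
    · exact congrArg Sum.inl (X.isTree.no_multi e f
        (Sym2.map.injective Sum.inl_injective h))
    · exact absurd h (key e f)
    · exact absurd h.symm (key f e)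
    · exact congrArg Sum.inr (Y.isTree.no_multi e f
        (Sym2.map.injective (glue_injective X Y) h))
  have : Finite (gluedGraph X Y).V :=
    inferInstanceAs (Finite (X.V ⊕ {y : Y.V // y ≠ Y.start}))
  refine ⟨h1, h2, SimpleGraph.isTree_iff_connected_and_card.2 ⟨?_, ?_⟩⟩
  · have : Nonempty (gluedGraph X Y).V := ⟨Sum.inl X.start⟩
    have hl : ∀ x x' : X.V, (gluedGraph X Y).underlying.Reachable (Sum.inl x) (Sum.inl x') := by
      intro x x'
      let f : X.underlying →g (gluedGraph X Y).underlying := ⟨Sum.inl, by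
        intro a b hab
        obtain ⟨hne, ⟨e, rfl, rfl⟩ | ⟨e, rfl, rfl⟩⟩ := LDigraph.adj_iff.1 hab
        · exact LDigraph.adj_iff.2 ⟨fun h => hne (Sum.inl_injective h),
            Or.inl ⟨Sum.inl e, rfl, rfl⟩⟩
        · exact LDigraph.adj_iff.2 ⟨fun h => hne (Sum.inl_injective h),
            Or.inr ⟨Sum.inl e, rfl, rfl⟩⟩⟩
      exact (X.isTree.tree.connected.preconnected x x').map f
    have hr : ∀ y y' : Y.V,
        (gluedGraph X Y).underlying.Reachable (glue X Y y) (glue X Y y') := by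
      intro y y'
      let f : Y.underlying →g (gluedGraph X Y).underlying := ⟨glue X Y, by
        intro a b hab
        obtain ⟨hne, ⟨e, rfl, rfl⟩ | ⟨e, rfl, rfl⟩⟩ := LDigraph.adj_iff.1 hab
        · exact LDigraph.adj_iff.2 ⟨fun h => hne (glue_injective X Y h),
            Or.inl ⟨Sum.inr e, rfl, rfl⟩⟩
        · exact LDigraph.adj_iff.2 ⟨fun h => hne (glue_injective X Y h),
            Or.inr ⟨Sum.inr e, rfl, rfl⟩⟩⟩
      exact (Y.isTree.tree.connected.preconnected y y').map f
    have hc : ∀ z : (gluedGraph X Y).V,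
        (gluedGraph X Y).underlying.Reachable (Sum.inl X.finish) z := by
      rintro (x | ⟨y, hy⟩)
      · exact hl _ _
      · have := hr Y.start y
        rwa [glue_start, glue_of_ne X Y hy] at this
    exact ⟨fun a b => (hc a).symm.trans (hc b)⟩
  · rw [LDigraph.card_edgeSet h1 h2]
    have hX := (SimpleGraph.isTree_iff_connected_and_card.1 X.isTree.tree).2
    have hY := (SimpleGraph.isTree_iff_connected_and_card.1 Y.isTree.tree).2
    rw [LDigraph.card_edgeSet X.isTree.no_loop X.isTree.no_multi] at hX
    rw [LDigraph.card_edgeSet Y.isTree.no_loop Y.isTree.no_multi] at hY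
    have e1 : Nat.card (gluedGraph X Y).E = Nat.card X.E + Nat.card Y.E := Nat.card_sum
    have e2 : Nat.card (gluedGraph X Y).V = Nat.card X.V + Nat.card {y : Y.V // y ≠ Y.start} :=
      Nat.card_sum
    have e3 : Nat.card Y.V = Nat.card {y : Y.V // y ≠ Y.start} + 1 := by
      classical
      have := Nat.card_congr (Equiv.sumCompl (fun y : Y.V => y ≠ Y.start))
      rw [Nat.card_sum] at this
      rw [← this]
      congr 1
      rw [Nat.card_eq_one_iff_unique]
      exact ⟨⟨fun a b => Subtype.ext ((not_not.1 a.2).trans (not_not.1 b.2).symm)⟩,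
        ⟨⟨Y.start, not_not.2 rfl⟩⟩⟩
    omega

/-- Unpruned multiplication `X × Y`: the end vertex of `X` is identified with the start vertex
of `Y`. -/
noncomputable def umul (X Y : SigmaTree A) : SigmaTree A where
  toLDigraph := gluedGraph X Y
  finV := inferInstanceAs (Finite (X.V ⊕ {y : Y.V // y ≠ Y.start}))
  finE := inferInstanceAs (Finite (X.E ⊕ Y.E))
  isTree := gluedGraph_isTree X Y
  start := Sum.inl X.start
  finish := glue X Y Y.finish
  path := by
    have h := gluedGraph_reach_right X Y Y.path
    rw [glue_start] at h
    exact (gluedGraph_reach_left X Y X.path).trans h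

theorem umul_congr {X X' Y Y' : SigmaTree A} (hX : Iso X X') (hY : Iso Y Y') :
    Iso (umul X Y) (umul X' Y') := by
  obtain ⟨f, hf⟩ := hX
  obtain ⟨g, hg⟩ := hY
  have hs : ∀ y : Y.V, y ≠ Y.start ↔ g.vmap y ≠ Y'.start := fun y => by
    rw [← g.map_start, hg.1.1.ne_iff]
  let φ : (X.V ⊕ {y : Y.V // y ≠ Y.start}) ≃ (X'.V ⊕ {y : Y'.V // y ≠ Y'.start}) :=
    Equiv.sumCongr (Equiv.ofBijective _ hf.1)
      ((Equiv.ofBijective _ hg.1).subtypeEquiv hs)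
  let ψ : (X.E ⊕ Y.E) ≃ (X'.E ⊕ Y'.E) :=
    Equiv.sumCongr (Equiv.ofBijective _ hf.2) (Equiv.ofBijective _ hg.2)
  have hφ : ∀ y, glue X' Y' (g.vmap y) = φ (glue X Y y) := by
    intro y
    by_cases hy : y = Y.start
    · subst hy
      rw [g.map_start, glue_start, glue_start, ← f.map_finish]
      rfl
    · rw [glue_of_ne X Y hy, glue_of_ne X' Y' ((hs y).1 hy)]
      rfl
  refine ⟨⟨φ, ψ, ?_, ?_, ?_, ?_, ?_⟩, φ.bijective, ψ.bijective⟩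
  · rintro (e | e)
    · exact congrArg Sum.inl (f.src_emap e)
    · exact (congrArg (glue X' Y') (g.src_emap e)).trans (hφ _)
  · rintro (e | e)
    · exact congrArg Sum.inl (f.tgt_emap e)
    · exact (congrArg (glue X' Y') (g.tgt_emap e)).trans (hφ _)
  · rintro (e | e)
    · exact f.label_emap e
    · exact g.label_emap e
  · exact congrArg Sum.inl f.map_start
  · exact (hφ _).symm.trans (congrArg (glue X' Y') g.map_finish)

theorem uplus_congr {X X' : SigmaTree A} (h : Iso X X') : Iso (uplus X) (uplus X') := by
  obtain ⟨f, hf⟩ := h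
  exact ⟨⟨f.vmap, f.emap, f.src_emap, f.tgt_emap, f.label_emap, f.map_start, f.map_start⟩, hf⟩

theorem ustar_congr {X X' : SigmaTree A} (h : Iso X X') : Iso (ustar X) (ustar X') := by
  obtain ⟨f, hf⟩ := h
  exact ⟨⟨f.vmap, f.emap, f.src_emap, f.tgt_emap, f.label_emap, f.map_finish, f.map_finish⟩, hf⟩

/-! ### Retractions and pruned trees -/

/-- A retraction of `X` is an idempotent morphism from `X` to `X`. -/
def Hom.IsRetraction {X : SigmaTree A} (p : Hom X X) : Prop := p.comp p = p

/-- The image of a retraction `p`: the subtree of `X` with vertices and edges in the image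
of `p`. -/
def imageGraph {X : SigmaTree A} (p : Hom X X) : LDigraph A where
  V := Set.range p.vmap
  E := Set.range p.emap
  src e := ⟨X.src e, by obtain ⟨_, e, rfl⟩ := e; exact ⟨_, (p.src_emap e).symm⟩⟩
  tgt e := ⟨X.tgt e, by obtain ⟨_, e, rfl⟩ := e; exact ⟨_, (p.tgt_emap e).symm⟩⟩
  label e := X.label e

theorem imageGraph_step {X : SigmaTree A} (p : Hom X X) {x y : X.V} (h : X.Step x y) :
    (imageGraph p).Step ⟨p.vmap x, x, rfl⟩ ⟨p.vmap y, y, rfl⟩ := by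
  obtain ⟨e, rfl, rfl⟩ := h
  exact ⟨⟨p.emap e, e, rfl⟩, Subtype.ext (p.src_emap e), Subtype.ext (p.tgt_emap e)⟩

theorem imageGraph_reach {X : SigmaTree A} (p : Hom X X) {x y : X.V} (h : X.Reach x y) :
    (imageGraph p).Reach ⟨p.vmap x, x, rfl⟩ ⟨p.vmap y, y, rfl⟩ :=
  Relation.ReflTransGen.lift (p := (imageGraph p).Step) (fun x => ⟨p.vmap x, x, rfl⟩)
    (fun _ _ => imageGraph_step p) _ _ h

/-- The image of a retraction, as a `Σ`-tree. -/
def image {X : SigmaTree A} (p : Hom X X) : SigmaTree A where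
  toLDigraph := imageGraph p
  finV := inferInstanceAs (Finite (Set.range p.vmap))
  finE := inferInstanceAs (Finite (Set.range p.emap))
  isTree := by
    have hne : ∀ e : X.E, p.vmap (X.src e) ≠ p.vmap (X.tgt e) := fun e h =>
      X.isTree.no_loop (p.emap e) (by rw [p.src_emap, p.tgt_emap, h])
    refine ⟨fun e h => X.isTree.no_loop e.1 (congrArg Subtype.val h), fun e f h => ?_, ?_, ?_⟩
    · exact Subtype.ext (X.isTree.no_multi e.1 f.1
        (congrArg (Sym2.map Subtype.val) h))
    · let f : X.underlying →g (imageGraph p).underlying := ⟨fun x => ⟨p.vmap x, x, rfl⟩, by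
        intro a b hab
        obtain ⟨-, h⟩ := LDigraph.adj_iff.1 hab
        refine LDigraph.adj_iff.2 ⟨fun hh => ?_,
          h.imp (imageGraph_step p) (imageGraph_step p)⟩
        have hh' : p.vmap a = p.vmap b := congrArg Subtype.val hh
        obtain ⟨e, rfl, rfl⟩ | ⟨e, rfl, rfl⟩ := h
        · exact hne e hh'
        · exact hne e hh'.symm⟩
      refine X.isTree.tree.connected.map f ?_
      rintro ⟨_, x, rfl⟩
      exact ⟨x, rfl⟩
    · let f : (imageGraph p).underlying →g X.underlying := ⟨Subtype.val, by
        intro a b hab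
        obtain ⟨hne, ⟨e, rfl, rfl⟩ | ⟨e, rfl, rfl⟩⟩ := LDigraph.adj_iff.1 hab
        · exact LDigraph.adj_iff.2 ⟨fun h => hne (Subtype.ext h), Or.inl ⟨e.1, rfl, rfl⟩⟩
        · exact LDigraph.adj_iff.2 ⟨fun h => hne (Subtype.ext h), Or.inr ⟨e.1, rfl, rfl⟩⟩⟩
      exact SimpleGraph.IsAcyclic.comap f Subtype.val_injective X.isTree.tree.isAcyclic
  start := ⟨p.vmap X.start, X.start, rfl⟩
  finish := ⟨p.vmap X.finish, X.finish, rfl⟩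
  path := imageGraph_reach p X.path

/-- `Y` is (isomorphic to) a retract of `X`. -/
def IsRetractOf (Y X : SigmaTree A) : Prop :=
  ∃ p : Hom X X, p.IsRetraction ∧ Iso Y (image p)

/-- A tree is pruned if it does not admit a non-identity retraction. -/
def IsPruned (X : SigmaTree A) : Prop := ∀ p : Hom X X, p.IsRetraction → p = Hom.id X

theorem isRetractOf_iff {Y X : SigmaTree A} :
    IsRetractOf Y X ↔ ∃ (i : Hom Y X) (r : Hom X Y), r.comp i = Hom.id Y := by
  constructor
  · rintro ⟨p, hp, f, hf⟩
    obtain ⟨g, h1, -⟩ := hf.exists_inv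
    let i : Hom (image p) X := ⟨Subtype.val, Subtype.val, fun _ => rfl, fun _ => rfl,
      fun _ => rfl, p.map_start, p.map_finish⟩
    let r : Hom X (image p) := ⟨fun x => ⟨p.vmap x, x, rfl⟩, fun e => ⟨p.emap e, e, rfl⟩,
      fun e => Subtype.ext (p.src_emap e), fun e => Subtype.ext (p.tgt_emap e), p.label_emap,
      rfl, rfl⟩
    have hri : r.comp i = Hom.id (image p) := by
      refine Hom.ext (funext ?_) (funext ?_)
      · rintro ⟨_, x, rfl⟩
        exact Subtype.ext (congrFun (congrArg Hom.vmap hp) x)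
      · rintro ⟨_, x, rfl⟩
        exact Subtype.ext (congrFun (congrArg Hom.emap hp) x)
    refine ⟨i.comp f, g.comp r, ?_⟩
    rw [Hom.comp_assoc, ← Hom.comp_assoc r i f, hri, Hom.id_comp, h1]
  · rintro ⟨i, r, h⟩
    have hv : ∀ y, r.vmap (i.vmap y) = y := congrFun (congrArg Hom.vmap h)
    have he : ∀ y, r.emap (i.emap y) = y := congrFun (congrArg Hom.emap h)
    refine ⟨i.comp r, ?_, ⟨fun y => ⟨i.vmap y, i.vmap y, congrArg i.vmap (hv y)⟩,
      fun e => ⟨i.emap e, i.emap e, congrArg i.emap (he e)⟩,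
      fun e => Subtype.ext (i.src_emap e), fun e => Subtype.ext (i.tgt_emap e), i.label_emap,
      Subtype.ext ?_, Subtype.ext ?_⟩, ⟨?_, ?_⟩, ⟨?_, ?_⟩⟩
    · exact Hom.ext (funext fun x => congrArg i.vmap (hv _))
        (funext fun x => congrArg i.emap (he _))
    · exact congrArg i.vmap r.map_start.symm
    · exact congrArg i.vmap r.map_finish.symm
    · intro a b hab
      have : i.vmap a = i.vmap b := congrArg Subtype.val hab
      rw [← hv a, this, hv]
    · rintro ⟨_, x, rfl⟩
      exact ⟨r.vmap x, rfl⟩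
    · intro a b hab
      have : i.emap a = i.emap b := congrArg Subtype.val hab
      rw [← he a, this, he]
    · rintro ⟨_, x, rfl⟩
      exact ⟨r.emap x, rfl⟩

theorem IsPruned.congr {X Y : SigmaTree A} (h : Iso X Y) (hX : IsPruned X) : IsPruned Y := by
  obtain ⟨f, hf⟩ := h
  obtain ⟨g, h1, h2⟩ := hf.exists_inv
  intro p hp
  have hq : (g.comp (p.comp f)).IsRetraction := by
    change g.comp (p.comp ((f.comp g).comp (p.comp f))) = _
    rw [h2, Hom.id_comp, ← Hom.comp_assoc p p f, hp]
  calc p = (f.comp g).comp (p.comp (f.comp g)) := by rw [h2]; rfl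
    _ = f.comp ((g.comp (p.comp f)).comp g) := rfl
    _ = Hom.id Y := by rw [hX _ hq, Hom.id_comp, h2]

/-- Every tree has a pruned retract. -/
theorem exists_pruned_retract (X : SigmaTree A) : ∃ Y, IsRetractOf Y X ∧ IsPruned Y := by
  induction hn : Nat.card X.V + Nat.card X.E using Nat.strong_induction_on generalizing X with
  | _ n ih =>
    subst hn
    by_cases hX : IsPruned X
    · exact ⟨X, isRetractOf_iff.2 ⟨Hom.id X, Hom.id X, rfl⟩, hX⟩
    · simp only [IsPruned, not_forall] at hX
      obtain ⟨p, hp, hne⟩ := hX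
      have hv : Nat.card (image p).V ≤ Nat.card X.V := Finite.card_subtype_le _
      have he : Nat.card (image p).E ≤ Nat.card X.E := Finite.card_subtype_le _
      have hlt : Nat.card (image p).V + Nat.card (image p).E < Nat.card X.V + Nat.card X.E := by
        by_contra hge
        have hv' : Nat.card (image p).V = Nat.card X.V := by omega
        have he' : Nat.card (image p).E = Nat.card X.E := by omega
        have sv : Set.range p.vmap = Set.univ := by
          apply Set.eq_of_subset_of_ncard_le (Set.subset_univ _)
          rw [Set.ncard_univ]; exact hv'.ge
        have se : Set.range p.emap = Set.univ := by
          apply Set.eq_of_subset_of_ncard_le (Set.subset_univ _)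
          rw [Set.ncard_univ]; exact he'.ge
        apply hne
        refine Hom.ext (funext fun x => ?_) (funext fun x => ?_)
        · obtain ⟨y, rfl⟩ := Set.range_eq_univ.1 sv x
          exact congrFun (congrArg Hom.vmap hp) y
        · obtain ⟨y, rfl⟩ := Set.range_eq_univ.1 se x
          exact congrFun (congrArg Hom.emap hp) y
      obtain ⟨Y, hY, hYp⟩ := ih _ hlt (image p) rfl
      obtain ⟨i, r, hir⟩ := isRetractOf_iff.1 hY
      obtain ⟨i', r', hir'⟩ := isRetractOf_iff.1 ⟨p, hp, Iso.refl (image p)⟩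
      refine ⟨Y, isRetractOf_iff.2 ⟨i'.comp i, r.comp r', ?_⟩, hYp⟩
      change r.comp ((r'.comp i').comp i) = _
      rw [hir', Hom.id_comp, hir]

instance homMonoid (X : SigmaTree A) : Monoid (Hom X X) where
  mul f g := f.comp g
  mul_assoc _ _ _ := rfl
  one := Hom.id X
  one_mul _ := rfl
  mul_one _ := rfl

instance homFinite (X Y : SigmaTree A) : Finite (Hom X Y) :=
  Finite.of_injective (fun f : Hom X Y => (f.vmap, f.emap)) fun _ _ h =>
    Hom.ext (congrArg Prod.fst h) (congrArg Prod.snd h)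

/-- An endomorphism of a pruned tree has an inverse. -/
theorem IsPruned.exists_inv {X : SigmaTree A} (hX : IsPruned X) (f : Hom X X) :
    ∃ g : Hom X X, g * f = 1 ∧ f * g = 1 := by
  obtain ⟨i, j, hij, h⟩ := Finite.exists_ne_map_eq_of_infinite (fun n : ℕ => f ^ n)
  wlog hlt : i < j generalizing i j
  · exact this j i hij.symm h.symm (lt_of_le_of_ne (not_lt.1 hlt) hij.symm)
  have h' : f ^ i = f ^ j := h
  obtain ⟨p, rfl⟩ := Nat.exists_eq_add_of_lt hlt
  have hper : ∀ n k, f ^ (i + n) = f ^ (i + n + k * (p + 1)) := by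
    intro n k
    induction k with
    | zero => simp
    | succ k ih =>
      have e : i + n + (k + 1) * (p + 1) = (i + p + 1) + (n + k * (p + 1)) := by ring
      have e' : i + n + k * (p + 1) = i + (n + k * (p + 1)) := by ring
      rw [ih, e, e', pow_add, pow_add f (i + p + 1), h']
  have hid : f ^ ((i + 1) * (p + 1)) * f ^ ((i + 1) * (p + 1)) = f ^ ((i + 1) * (p + 1)) := by
    have e : (i + 1) * (p + 1) = i + (i * p + p + 1) := by ring
    have := hper (i * p + p + 1) (i + 1)
    rw [← e] at this
    rw [← pow_add, ← this]
  have h1 : f ^ ((i + 1) * (p + 1)) = 1 := hX _ hid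
  have e : (i + 1) * (p + 1) = (i * p + i + p) + 1 := by ring
  rw [e] at h1
  exact ⟨f ^ (i * p + i + p), by rw [← pow_succ, h1], by rw [← pow_succ', h1]⟩

/-- The pruned retract is unique up to isomorphism. -/
theorem pruned_retract_unique {X Y Z : SigmaTree A} (hY : IsRetractOf Y X) (hZ : IsRetractOf Z X)
    (pY : IsPruned Y) (pZ : IsPruned Z) : Iso Y Z := by
  obtain ⟨i, r, -⟩ := isRetractOf_iff.1 hY
  obtain ⟨j, s, -⟩ := isRetractOf_iff.1 hZ
  let a : Hom Y Z := s.comp i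
  let b : Hom Z Y := r.comp j
  obtain ⟨g, hg, -⟩ := pY.exists_inv (b.comp a)
  obtain ⟨k, -, hk⟩ := pZ.exists_inv (a.comp b)
  have h1 : (g.comp b).comp a = Hom.id Y := hg
  have h2 : a.comp (b.comp k) = Hom.id Z := hk
  have h3 : g.comp b = b.comp k := by
    calc g.comp b = (g.comp b).comp (a.comp (b.comp k)) := by rw [h2]; rfl
      _ = ((g.comp b).comp a).comp (b.comp k) := rfl
      _ = b.comp k := by rw [h1]; rfl
  exact ⟨a, Hom.isIso_of_inv h1 (by rw [h3, h2])⟩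

/-- A representative of the pruning of `X`: a pruned retract of `X`. -/
noncomputable def pruneRep (X : SigmaTree A) : SigmaTree A := (exists_pruned_retract X).choose

theorem pruneRep_isRetractOf (X : SigmaTree A) : IsRetractOf (pruneRep X) X :=
  (exists_pruned_retract X).choose_spec.1

theorem pruneRep_isPruned (X : SigmaTree A) : IsPruned (pruneRep X) :=
  (exists_pruned_retract X).choose_spec.2

theorem pruneRep_congr {X Y : SigmaTree A} (h : Iso X Y) : Iso (pruneRep X) (pruneRep Y) := by
  obtain ⟨f, hf⟩ := h
  obtain ⟨g, h1, -⟩ := hf.exists_inv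
  obtain ⟨i, r, hir⟩ := isRetractOf_iff.1 (pruneRep_isRetractOf X)
  refine pruned_retract_unique (X := Y) (isRetractOf_iff.2 ⟨f.comp i, r.comp g, ?_⟩)
    (pruneRep_isRetractOf Y) (pruneRep_isPruned X) (pruneRep_isPruned Y)
  change r.comp ((g.comp f).comp i) = _
  rw [h1, Hom.id_comp, hir]

/-! ### Closure properties of left and right adequate trees -/

theorem IsLeftAdequate.congr {X Y : SigmaTree A} (h : Iso X Y) (hX : X.IsLeftAdequate) :
    Y.IsLeftAdequate := by
  obtain ⟨f, hf⟩ := h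
  intro y
  obtain ⟨x, rfl⟩ := hf.1.2 y
  rw [← f.map_start]
  exact f.reach (hX x)

theorem IsRightAdequate.congr {X Y : SigmaTree A} (h : Iso X Y) (hX : X.IsRightAdequate) :
    Y.IsRightAdequate := by
  obtain ⟨f, hf⟩ := h
  intro y
  obtain ⟨x, rfl⟩ := hf.1.2 y
  rw [← f.map_finish]
  exact f.reach (hX x)

theorem IsLeftAdequate.pruneRep {X : SigmaTree A} (hX : X.IsLeftAdequate) :
    (pruneRep X).IsLeftAdequate := by
  obtain ⟨i, r, h⟩ := isRetractOf_iff.1 (pruneRep_isRetractOf X)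
  intro y
  have := r.reach (hX (i.vmap y))
  rwa [r.map_start, show r.vmap (i.vmap y) = y from congrFun (congrArg Hom.vmap h) y] at this

theorem IsRightAdequate.pruneRep {X : SigmaTree A} (hX : X.IsRightAdequate) :
    (pruneRep X).IsRightAdequate := by
  obtain ⟨i, r, h⟩ := isRetractOf_iff.1 (pruneRep_isRetractOf X)
  intro y
  have := r.reach (hX (i.vmap y))
  rwa [r.map_finish, show r.vmap (i.vmap y) = y from congrFun (congrArg Hom.vmap h) y] at this

theorem IsLeftAdequate.umul {X Y : SigmaTree A} (hX : X.IsLeftAdequate) (hY : Y.IsLeftAdequate) :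
    (umul X Y).IsLeftAdequate := by
  rintro (x | ⟨y, hy⟩)
  · exact gluedGraph_reach_left X Y (hX x)
  · have h := gluedGraph_reach_right X Y (hY y)
    rw [glue_start, glue_of_ne X Y hy] at h
    exact (gluedGraph_reach_left X Y X.path).trans h

theorem IsRightAdequate.umul {X Y : SigmaTree A} (hX : X.IsRightAdequate)
    (hY : Y.IsRightAdequate) : (umul X Y).IsRightAdequate := by
  rintro (x | ⟨y, hy⟩)
  · have h := gluedGraph_reach_right X Y Y.path
    rw [glue_start] at h
    exact (gluedGraph_reach_left X Y (hX x)).trans h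
  · have h := gluedGraph_reach_right X Y (hY y)
    rwa [glue_of_ne X Y hy] at h

theorem trivial_isPruned : (trivial A).IsPruned := fun _ _ =>
  Hom.ext rfl (funext fun e => e.elim)

theorem base_isPruned (a : A) : (base a).IsPruned := fun p _ =>
  Hom.ext (funext fun x => by
    rcases x with _ | _
    · exact p.map_start
    · exact p.map_finish) rfl

end SigmaTree

/-! ### Isomorphism types and the pruned operations -/

/-- `UT¹(Σ)`: isomorphism types of `Σ`-trees. -/
def UT (A : Type u) : Type (max 1 u) := Quotient (SigmaTree.isoSetoid A)

namespace UT

variable {A : Type u}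

/-- Unpruned multiplication of isomorphism types. -/
noncomputable def mul : UT A → UT A → UT A :=
  Quotient.map₂ SigmaTree.umul fun _ _ h _ _ h' => SigmaTree.umul_congr h h'

/-- Unpruned `(+)`. -/
def plus : UT A → UT A := Quotient.map SigmaTree.uplus fun _ _ h => SigmaTree.uplus_congr h

/-- Unpruned `(*)`. -/
def star : UT A → UT A := Quotient.map SigmaTree.ustar fun _ _ h => SigmaTree.ustar_congr h

def IsPruned : UT A → Prop :=
  Quotient.lift SigmaTree.IsPruned fun _ _ h =>
    propext ⟨fun hX => hX.congr h, fun hY => hY.congr (SigmaTree.Iso.symm h)⟩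

def IsLeftAdequate : UT A → Prop :=
  Quotient.lift SigmaTree.IsLeftAdequate fun _ _ h =>
    propext ⟨fun hX => hX.congr h, fun hY => hY.congr (SigmaTree.Iso.symm h)⟩

def IsRightAdequate : UT A → Prop :=
  Quotient.lift SigmaTree.IsRightAdequate fun _ _ h =>
    propext ⟨fun hX => hX.congr h, fun hY => hY.congr (SigmaTree.Iso.symm h)⟩

/-- The pruning: the unique (isomorphism type of a) pruned retract. -/
noncomputable def prune : UT A → UT A :=
  Quotient.map SigmaTree.pruneRep fun _ _ h => SigmaTree.pruneRep_congr h

theorem prune_isPruned (X : UT A) : X.prune.IsPruned :=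
  Quotient.inductionOn X SigmaTree.pruneRep_isPruned

theorem IsLeftAdequate.prune {X : UT A} : X.IsLeftAdequate → X.prune.IsLeftAdequate :=
  Quotient.inductionOn X fun _ h => SigmaTree.IsLeftAdequate.pruneRep h

theorem IsRightAdequate.prune {X : UT A} : X.IsRightAdequate → X.prune.IsRightAdequate :=
  Quotient.inductionOn X fun _ h => SigmaTree.IsRightAdequate.pruneRep h

theorem IsLeftAdequate.mul {X Y : UT A} :
    X.IsLeftAdequate → Y.IsLeftAdequate → (UT.mul X Y).IsLeftAdequate :=
  Quotient.inductionOn₂ X Y fun _ _ h h' => SigmaTree.IsLeftAdequate.umul h h'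

theorem IsRightAdequate.mul {X Y : UT A} :
    X.IsRightAdequate → Y.IsRightAdequate → (UT.mul X Y).IsRightAdequate :=
  Quotient.inductionOn₂ X Y fun _ _ h h' => SigmaTree.IsRightAdequate.umul h h'

theorem IsLeftAdequate.plus {X : UT A} : X.IsLeftAdequate → (UT.plus X).IsLeftAdequate :=
  Quotient.inductionOn X fun _ h => h

theorem IsRightAdequate.star {X : UT A} : X.IsRightAdequate → (UT.star X).IsRightAdequate :=
  Quotient.inductionOn X fun _ h => h

end UT

/-- `T¹(Σ)`: isomorphism types of pruned `Σ`-trees. -/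
def PT (A : Type u) : Type (max 1 u) := {X : UT A // X.IsPruned}

namespace PT

variable {A : Type u}

/-- The isomorphism type of the trivial tree. -/
def one (A : Type u) : PT A := ⟨Quotient.mk _ (SigmaTree.trivial A), SigmaTree.trivial_isPruned⟩

/-- The isomorphism type of the base tree of a letter. -/
def base (a : A) : PT A := ⟨Quotient.mk _ (SigmaTree.base a), SigmaTree.base_isPruned a⟩

/-- Pruned multiplication. -/
noncomputable def mul (X Y : PT A) : PT A := ⟨(UT.mul X.1 Y.1).prune, UT.prune_isPruned _⟩

/-- Pruned `+`. -/
noncomputable def plus (X : PT A) : PT A := ⟨(UT.plus X.1).prune, UT.prune_isPruned _⟩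

/-- Pruned `*`. -/
noncomputable def star (X : PT A) : PT A := ⟨(UT.star X.1).prune, UT.prune_isPruned _⟩

end PT

/-- `LT¹(Σ)`: isomorphism types of pruned left adequate `Σ`-trees. -/
def LT (A : Type u) : Type (max 1 u) := {X : PT A // X.1.IsLeftAdequate}

/-- `RT¹(Σ)`: isomorphism types of pruned right adequate `Σ`-trees. -/
def RT (A : Type u) : Type (max 1 u) := {X : PT A // X.1.IsRightAdequate}

/-- `LT¹(Σ)` with pruned multiplication, the trivial tree and pruned `+`. -/
noncomputable instance LT.instAlg (A : Type u) : Alg210 (LT A) where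
  mul X Y := ⟨PT.mul X.1 Y.1, (X.2.mul Y.2).prune⟩
  one := ⟨PT.one A, fun _ => Relation.ReflTransGen.refl⟩
  un X := ⟨PT.plus X.1, X.2.plus.prune⟩

/-- `RT¹(Σ)` with pruned multiplication, the trivial tree and pruned `*`. -/
noncomputable instance RT.instAlg (A : Type u) : Alg210 (RT A) where
  mul X Y := ⟨PT.mul X.1 Y.1, (X.2.mul Y.2).prune⟩
  one := ⟨PT.one A, fun _ => Relation.ReflTransGen.refl⟩
  un X := ⟨PT.star X.1, X.2.star.prune⟩

/-- The base tree of a letter, as an element of `LT¹(Σ)`. -/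
def LT.base {A : Type u} (a : A) : LT A := ⟨PT.base a, fun x => by
  rcases x with _ | _
  · exact Relation.ReflTransGen.refl
  · exact (SigmaTree.base a).path⟩

/-- The base tree of a letter, as an element of `RT¹(Σ)`. -/
def RT.base {A : Type u} (a : A) : RT A := ⟨PT.base a, fun x => by
  rcases x with _ | _
  · exact (SigmaTree.base a).path
  · exact Relation.ReflTransGen.refl⟩

end AdequateTrees

/-!
Two observations reduce the theorem to algebra of finite rooted trees.

First, two `Σ`-trees have isomorphic prunings exactly when there are morphisms between them in both
directions (`SigmaTree.iso_pruneRep_iff`). So `LT¹(Σ)` is the set of left adequate trees modulo this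
*morphism equivalence*, and equations in it are proved by exhibiting morphisms. Since `X × Y` is a
pushout, morphisms out of it are easy to give. In a left adequate tree no vertex has two incoming
edges; hence two maps that agree at `y` agree at all vertices from which `y` can be reached
(`LDigraph.GHom.eq_of_reach`). This rigidity shows that idempotents are trees whose start and end
vertices coincide, so that idempotents commute, and that a morphism `Z × X → Y × X` respects the
glueing points, so that it is also a morphism `Z × X⁺ → Y × X⁺`; the latter is the main part of
`X R* X⁺`.

Second, let `χ : Σ → M` be a function to a left adequate monoid. Give each vertex `v` of a left
adequate tree the idempotent `cone v = ∏ (χ(a) cone(w))⁺`, the product over the edges `v → w`, with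
`a` the label of the edge, and let the value of the tree be the product
`cone(v₀) χ(a₁) cone(v₁) ⋯ χ(aₙ) cone(vₙ)` along the directed path from start to end. Morphisms can
only decrease `cone`, and the composites of morphisms `X → Y → X` fix the vertices of that path;
hence the value is an invariant of morphism equivalence (`SigmaTree.value_eq_of_homEquiv`). It is
multiplicative (`SigmaTree.value_umul`) and compatible with `+`, so it defines a morphism
`LT¹(Σ) → M` that extends `χ`.

For uniqueness, apply this construction to `M = LT¹(Σ)` and to the map that sends letters to base
trees: the value of a tree `X` is then the class of `X` itself (`LT.value_base_eq_ofTree`). So every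
element of `LT¹(Σ)` is obtained from base trees by the operations, in a way that every morphism
`f` translates into the value for `χ = f ∘ base`. The identity is proved by letting `LT¹(Σ)` act by
relations on the vertices of digraphs: `x` relates `z` to `z'` if a tree representing `x` can be
mapped into the digraph with its start vertex going to `z` and its end vertex to `z'`.

The statement on right adequate monoids follows by reversing edges, which is an anti-isomorphism
from `RT¹(Σ)` to `LT¹(Σ)`, and by passing to the opposite monoid.
-/

namespace AdequateTrees

/-! ### Morphisms of labelled digraphs -/

namespace LDigraph

variable {A : Type u}

/-- Morphisms of labelled digraphs. Unlike a morphism of `Σ`-trees, such a map need not respect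
any start or end vertices. -/
structure GHom (D D' : LDigraph A) where
  vmap : D.V → D'.V
  emap : D.E → D'.E
  src_emap : ∀ e, D'.src (emap e) = vmap (D.src e)
  tgt_emap : ∀ e, D'.tgt (emap e) = vmap (D.tgt e)
  label_emap : ∀ e, D'.label (emap e) = D.label e

namespace GHom

/-- The identity morphism. -/
def id (D : LDigraph A) : GHom D D :=
  ⟨fun x => x, fun e => e, fun _ => rfl, fun _ => rfl, fun _ => rfl⟩

/-- Composition of morphisms: `g.comp f` is `f` followed by `g`. -/
def comp {D D' D'' : LDigraph A} (g : GHom D' D'') (f : GHom D D') : GHom D D'' where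
  vmap := g.vmap ∘ f.vmap
  emap := g.emap ∘ f.emap
  src_emap e := by simp [g.src_emap, f.src_emap]
  tgt_emap e := by simp [g.tgt_emap, f.tgt_emap]
  label_emap e := by simp [g.label_emap, f.label_emap]

/-- Rigidity: if every vertex of the codomain has at most one incoming edge, then two morphisms
which agree at `y` agree at every vertex from which `y` can be reached. -/
theorem eq_of_reach {D D' : LDigraph A} (h : Function.Injective D'.tgt) (f g : GHom D D')
    {x y : D.V} (hxy : D.Reach x y) (hy : f.vmap y = g.vmap y) : f.vmap x = g.vmap x := by
  induction hxy using Relation.ReflTransGen.head_induction_on with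
  | refl => exact hy
  | head hs _ ih =>
    obtain ⟨e, rfl, rfl⟩ := hs
    have he : f.emap e = g.emap e := h (by rw [f.tgt_emap, g.tgt_emap, ih])
    rw [← f.src_emap, ← g.src_emap, he]

end GHom

end LDigraph

namespace SigmaTree

open LDigraph (GHom)

variable {A : Type u}

/-- The morphism of digraphs underlying a morphism of `Σ`-trees. -/
def Hom.toGHom {X Y : SigmaTree A} (f : Hom X Y) : GHom X.toLDigraph Y.toLDigraph :=
  ⟨f.vmap, f.emap, f.src_emap, f.tgt_emap, f.label_emap⟩

theorem nonempty_hom_iff {X Y : SigmaTree A} : Nonempty (Hom X Y) ↔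
    ∃ f : GHom X.toLDigraph Y.toLDigraph, f.vmap X.start = Y.start ∧ f.vmap X.finish = Y.finish :=
  ⟨fun ⟨f⟩ => ⟨f.toGHom, f.map_start, f.map_finish⟩, fun ⟨f, h1, h2⟩ =>
    ⟨⟨f.vmap, f.emap, f.src_emap, f.tgt_emap, f.label_emap, h1, h2⟩⟩⟩

/-! ### Morphisms into and out of products -/

/-- The inclusion of `X` into `X × Y`. -/
noncomputable def inlG (X Y : SigmaTree A) : GHom X.toLDigraph (umul X Y).toLDigraph :=
  ⟨Sum.inl, Sum.inl, fun _ => rfl, fun _ => rfl, fun _ => rfl⟩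

/-- The inclusion of `Y` into `X × Y`. -/
noncomputable def inrG (X Y : SigmaTree A) : GHom Y.toLDigraph (umul X Y).toLDigraph :=
  ⟨glue X Y, Sum.inr, fun _ => rfl, fun _ => rfl, fun _ => rfl⟩

/-- The product `X × Y` is a pushout of labelled digraphs. -/
theorem exists_umul_lift {X Y : SigmaTree A} {D : LDigraph A} (f : GHom X.toLDigraph D)
    (g : GHom Y.toLDigraph D) (h : f.vmap X.finish = g.vmap Y.start) :
    ∃ k : GHom (umul X Y).toLDigraph D,
      (∀ x, k.vmap (Sum.inl x) = f.vmap x) ∧ ∀ y, k.vmap (glue X Y y) = g.vmap y := by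
  have hg : ∀ y, Sum.elim f.vmap (fun y : {y : Y.V // y ≠ Y.start} => g.vmap y.1) (glue X Y y) =
      g.vmap y := by
    intro y
    by_cases hy : y = Y.start
    · rw [hy, glue_start, ← h]; rfl
    · rw [glue_of_ne X Y hy]; rfl
  refine ⟨⟨Sum.elim f.vmap (fun y => g.vmap y.1), Sum.elim f.emap g.emap, ?_, ?_, ?_⟩,
    fun _ => rfl, hg⟩
  · rintro (e | e)
    · exact f.src_emap e
    · exact (g.src_emap e).trans (hg _).symm
  · rintro (e | e)
    · exact f.tgt_emap e
    · exact (g.tgt_emap e).trans (hg _).symm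
  · rintro (e | e)
    · exact f.label_emap e
    · exact g.label_emap e

theorem exists_umul_gHom_iff {X Y : SigmaTree A} {D : LDigraph A} {z z' : D.V} :
    (∃ k : GHom (umul X Y).toLDigraph D,
        k.vmap (umul X Y).start = z ∧ k.vmap (umul X Y).finish = z') ↔
      ∃ t, (∃ f : GHom X.toLDigraph D, f.vmap X.start = z ∧ f.vmap X.finish = t) ∧
        ∃ g : GHom Y.toLDigraph D, g.vmap Y.start = t ∧ g.vmap Y.finish = z' := by
  constructor
  · rintro ⟨k, h1, h2⟩
    refine ⟨k.vmap (Sum.inl X.finish), ⟨k.comp (inlG X Y), h1, rfl⟩, k.comp (inrG X Y), ?_, h2⟩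
    exact congrArg k.vmap (glue_start X Y)
  · rintro ⟨t, ⟨f, h1, h2⟩, g, h3, h4⟩
    obtain ⟨k, hk1, hk2⟩ := exists_umul_lift f g (h2.trans h3.symm)
    exact ⟨k, (hk1 _).trans h1, (hk2 _).trans h4⟩

theorem nonempty_hom_umul {X Y Z : SigmaTree A} :
    Nonempty (Hom (umul X Y) Z) ↔
      ∃ t, (∃ f : GHom X.toLDigraph Z.toLDigraph, f.vmap X.start = Z.start ∧ f.vmap X.finish = t) ∧
        ∃ g : GHom Y.toLDigraph Z.toLDigraph, g.vmap Y.start = t ∧ g.vmap Y.finish = Z.finish :=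
  nonempty_hom_iff.trans exists_umul_gHom_iff

/-! ### Morphism equivalence and pruning -/

/-- Two trees are morphism equivalent if there are morphisms between them in both directions. -/
def HomEquiv (X Y : SigmaTree A) : Prop := Nonempty (Hom X Y) ∧ Nonempty (Hom Y X)

namespace HomEquiv

theorem symm {X Y : SigmaTree A} (h : HomEquiv X Y) : HomEquiv Y X := ⟨h.2, h.1⟩

theorem trans {X Y Z : SigmaTree A} (h : HomEquiv X Y) (h' : HomEquiv Y Z) : HomEquiv X Z := by
  obtain ⟨⟨f⟩, ⟨g⟩⟩ := h
  obtain ⟨⟨f'⟩, ⟨g'⟩⟩ := h'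
  exact ⟨⟨f'.comp f⟩, ⟨g.comp g'⟩⟩

end HomEquiv

theorem Iso.homEquiv {X Y : SigmaTree A} (h : Iso X Y) : HomEquiv X Y := by
  obtain ⟨f, -⟩ := id h
  obtain ⟨g, -⟩ := h.symm
  exact ⟨⟨f⟩, ⟨g⟩⟩

theorem homEquiv_pruneRep (X : SigmaTree A) : HomEquiv (pruneRep X) X := by
  obtain ⟨i, r, -⟩ := isRetractOf_iff.1 (pruneRep_isRetractOf X)
  exact ⟨⟨i⟩, ⟨r⟩⟩

theorem IsPruned.iso_of_homEquiv {X Y : SigmaTree A} (hX : X.IsPruned) (hY : Y.IsPruned)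
    (h : HomEquiv X Y) : Iso X Y := by
  obtain ⟨⟨a⟩, ⟨b⟩⟩ := h
  obtain ⟨g, hg, -⟩ := hX.exists_inv (b.comp a)
  obtain ⟨k, -, hk⟩ := hY.exists_inv (a.comp b)
  have h1 : (g.comp b).comp a = Hom.id X := hg
  have h2 : a.comp (b.comp k) = Hom.id Y := hk
  have h3 : g.comp b = b.comp k := by
    calc g.comp b = (g.comp b).comp (a.comp (b.comp k)) := by rw [h2]; rfl
      _ = ((g.comp b).comp a).comp (b.comp k) := rfl
      _ = b.comp k := by rw [h1]; rfl
  exact ⟨a, Hom.isIso_of_inv h1 (by rw [h3, h2])⟩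

/-- Pruning is a complete invariant of morphism equivalence. -/
theorem iso_pruneRep_iff {X Y : SigmaTree A} : Iso (pruneRep X) (pruneRep Y) ↔ HomEquiv X Y :=
  ⟨fun h => ((homEquiv_pruneRep X).symm.trans h.homEquiv).trans (homEquiv_pruneRep Y), fun h =>
    (pruneRep_isPruned X).iso_of_homEquiv (pruneRep_isPruned Y)
      (((homEquiv_pruneRep X).trans h).trans (homEquiv_pruneRep Y).symm)⟩

theorem nonempty_hom_umul_congr {X X' Y Y' : SigmaTree A} (hX : Nonempty (Hom X X'))
    (hY : Nonempty (Hom Y Y')) : Nonempty (Hom (umul X Y) (umul X' Y')) := by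
  obtain ⟨f⟩ := hX
  obtain ⟨g⟩ := hY
  refine nonempty_hom_umul.2 ⟨Sum.inl X'.finish,
    ⟨(inlG X' Y').comp f.toGHom, congrArg Sum.inl f.map_start, congrArg Sum.inl f.map_finish⟩,
    (inrG X' Y').comp g.toGHom, ?_, congrArg (glue X' Y') g.map_finish⟩
  exact (congrArg (glue X' Y') g.map_start).trans (glue_start X' Y')

theorem HomEquiv.umul {X X' Y Y' : SigmaTree A} (hX : HomEquiv X X') (hY : HomEquiv Y Y') :
    HomEquiv (umul X Y) (umul X' Y') :=
  ⟨nonempty_hom_umul_congr hX.1 hY.1, nonempty_hom_umul_congr hX.2 hY.2⟩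

theorem nonempty_hom_uplus_congr {X Y : SigmaTree A} (h : Nonempty (Hom X Y)) :
    Nonempty (Hom (uplus X) (uplus Y)) :=
  h.map fun f => ⟨f.vmap, f.emap, f.src_emap, f.tgt_emap, f.label_emap, f.map_start, f.map_start⟩

theorem HomEquiv.uplus {X Y : SigmaTree A} (h : HomEquiv X Y) : HomEquiv (uplus X) (uplus Y) :=
  ⟨nonempty_hom_uplus_congr h.1, nonempty_hom_uplus_congr h.2⟩

theorem homEquiv_umul_assoc (X Y Z : SigmaTree A) :
    HomEquiv (SigmaTree.umul (SigmaTree.umul X Y) Z) (SigmaTree.umul X (SigmaTree.umul Y Z)) := by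
  have key : ∀ {D : LDigraph A} {z z' : D.V},
      (∃ k : GHom (SigmaTree.umul (SigmaTree.umul X Y) Z).toLDigraph D,
        k.vmap (SigmaTree.umul (SigmaTree.umul X Y) Z).start = z ∧
        k.vmap (SigmaTree.umul (SigmaTree.umul X Y) Z).finish = z') ↔
      (∃ k : GHom (SigmaTree.umul X (SigmaTree.umul Y Z)).toLDigraph D,
        k.vmap (SigmaTree.umul X (SigmaTree.umul Y Z)).start = z ∧
        k.vmap (SigmaTree.umul X (SigmaTree.umul Y Z)).finish = z') := by
    intro D z z'
    simp only [exists_umul_gHom_iff]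
    exact ⟨fun ⟨t, ⟨s, hx, hy⟩, hz⟩ => ⟨s, hx, t, hy, hz⟩,
      fun ⟨s, hx, t, hy, hz⟩ => ⟨t, ⟨s, hx, hy⟩, hz⟩⟩
  exact ⟨nonempty_hom_iff.2 (key.2 ⟨GHom.id _, rfl, rfl⟩),
    nonempty_hom_iff.2 (key.1 ⟨GHom.id _, rfl, rfl⟩)⟩

/-- The morphism from the trivial tree that picks out a vertex. -/
def trivialG {D : LDigraph A} (z : D.V) : GHom (trivial A).toLDigraph D :=
  ⟨fun _ => z, Empty.elim, fun e => e.elim, fun e => e.elim, fun e => e.elim⟩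

/-- The morphism from a base tree that picks out an edge. -/
def baseG {D : LDigraph A} (e : D.E) : GHom (base (D.label e)).toLDigraph D where
  vmap := fun b : Bool => cond b (D.tgt e) (D.src e)
  emap _ := e
  src_emap _ := rfl
  tgt_emap _ := rfl
  label_emap _ := rfl

theorem homEquiv_trivial_umul (X : SigmaTree A) : HomEquiv (SigmaTree.umul (trivial A) X) X :=
  ⟨nonempty_hom_umul.2 ⟨X.start, ⟨trivialG _, rfl, rfl⟩, GHom.id _, rfl, rfl⟩,
    nonempty_hom_iff.2 ⟨inrG _ _, glue_start _ _, rfl⟩⟩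

theorem homEquiv_umul_trivial (X : SigmaTree A) : HomEquiv (SigmaTree.umul X (trivial A)) X :=
  ⟨nonempty_hom_umul.2 ⟨X.finish, ⟨GHom.id _, rfl, rfl⟩, trivialG _, rfl, rfl⟩,
    nonempty_hom_iff.2 ⟨inlG _ _, rfl, (glue_start X (trivial A)).symm⟩⟩

end SigmaTree
end AdequateTrees

namespace AdequateTrees

open LDigraph (GHom)

namespace SigmaTree

variable {A : Type u}

/-! ### The structure of left adequate trees -/

/-- In a left adequate tree the start vertex and the targets of the edges enumerate the vertices
without repetition: the enumeration is onto, and a tree has one edge less than it has vertices. -/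
theorem IsLeftAdequate.bijective_elim {X : SigmaTree A} (hX : X.IsLeftAdequate) :
    Function.Bijective (fun o : Option X.E => o.elim X.start X.tgt) := by
  have hcard := (SimpleGraph.isTree_iff_connected_and_card.1 X.isTree.tree).2
  rw [LDigraph.card_edgeSet X.isTree.no_loop X.isTree.no_multi] at hcard
  refine (Nat.bijective_iff_surjective_and_card _).2 ⟨fun x => ?_, ?_⟩
  · rcases Relation.ReflTransGen.cases_tail (hX x) with h | ⟨y, -, e, -, rfl⟩
    · exact ⟨none, h.symm⟩
    · exact ⟨some e, rfl⟩
  · rw [← hcard, Finite.card_option]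

namespace IsLeftAdequate

theorem tgt_injective {X : SigmaTree A} (hX : X.IsLeftAdequate) : Function.Injective X.tgt :=
  fun _ _ h => Option.some_injective _ (hX.bijective_elim.1 h)

theorem tgt_ne_start {X : SigmaTree A} (hX : X.IsLeftAdequate) (e : X.E) : X.tgt e ≠ X.start :=
  fun h => Option.some_ne_none e (hX.bijective_elim.1 h)

theorem wellFounded_step {X : SigmaTree A} (hX : X.IsLeftAdequate) : WellFounded X.Step := by
  refine ⟨fun x => ?_⟩
  induction hX x with
  | refl => exact ⟨_, fun y ⟨e, _, he⟩ => absurd he (hX.tgt_ne_start e)⟩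
  | tail _ hs ih =>
    refine ⟨_, fun y ⟨e, he, he'⟩ => ?_⟩
    obtain ⟨f, hf, hf'⟩ := hs
    rw [← he, hX.tgt_injective (he'.trans hf'.symm), hf]
    exact ih

theorem not_reach_tgt_src {X : SigmaTree A} (hX : X.IsLeftAdequate) (e : X.E) :
    ¬ X.Reach (X.tgt e) (X.src e) := fun h => by
  have := Relation.TransGen.head' ⟨e, rfl, rfl⟩ h
  exact (hX.wellFounded_step.transGen.irrefl).irrefl _ this

theorem wellFounded_flip_step {X : SigmaTree A} (hX : X.IsLeftAdequate) :
    WellFounded (flip X.Step) := by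
  have : Std.Irrefl (flip (Relation.TransGen X.Step)) :=
    ⟨fun a h => hX.wellFounded_step.transGen.irrefl.irrefl a h⟩
  have : IsTrans X.V (flip (Relation.TransGen X.Step)) := ⟨fun a b c h h' => h'.trans h⟩
  exact Subrelation.wf (r := flip (Relation.TransGen X.Step)) (fun h => .single h)
    (Finite.wellFounded_of_trans_of_irrefl _)

/-- Different edges with the same source lead to disjoint parts of the tree. -/
theorem edge_unique {X : SigmaTree A} (hX : X.IsLeftAdequate) {e f : X.E} {x : X.V}
    (h : X.src e = X.src f) (he : X.Reach (X.tgt e) x) (hf : X.Reach (X.tgt f) x) : e = f := by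
  have aux : ∀ {e f : X.E}, X.src e = X.src f → X.Reach (X.tgt e) (X.tgt f) → e = f := by
    intro e f h hr
    rcases Relation.ReflTransGen.cases_tail hr with h' | ⟨y, hy, g, rfl, hg⟩
    · exact hX.tgt_injective h'.symm
    · rw [hX.tgt_injective hg, ← h] at hy
      exact absurd hy (hX.not_reach_tgt_src e)
  have hu : Relator.RightUnique (Function.swap X.Step) := by
    rintro _ _ _ ⟨e, rfl, rfl⟩ ⟨f, rfl, hf⟩
    rw [hX.tgt_injective hf]
  rcases Relation.ReflTransGen.total_of_right_unique hu
    (Relation.reflTransGen_swap.2 he) (Relation.reflTransGen_swap.2 hf) with h' | h'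
  · exact (aux h.symm (Relation.reflTransGen_swap.1 h')).symm
  · exact aux h (Relation.reflTransGen_swap.1 h')

/-- A morphism between products with the same right factor maps the glueing point to the glueing
point. -/
theorem vmap_inl_finish {X Y Z : SigmaTree A} (hX : X.IsLeftAdequate) (hY : Y.IsLeftAdequate)
    (f : Hom (SigmaTree.umul Z X) (SigmaTree.umul Y X)) :
    f.vmap (Sum.inl Z.finish) = Sum.inl Y.finish := by
  have h := GHom.eq_of_reach (hY.umul hX).tgt_injective (f.toGHom.comp (inrG Z X)) (inrG Y X)
    X.path f.map_finish
  have h' : f.vmap (glue Z X X.start) = glue Y X X.start := h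
  rwa [glue_start, glue_start] at h'

theorem start_eq_finish_of_homEquiv {X : SigmaTree A} (hX : X.IsLeftAdequate)
    (h : HomEquiv (SigmaTree.umul X X) X) : X.start = X.finish := by
  obtain ⟨f⟩ := h.2
  have h := GHom.eq_of_reach (hX.umul hX).tgt_injective f.toGHom (inrG X X) X.path f.map_finish
  have h' : f.vmap X.start = glue X X X.start := h
  rw [f.map_start, glue_start] at h'
  exact Sum.inl_injective h'

end IsLeftAdequate

theorem homEquiv_umul_comm {X Y : SigmaTree A} (hX : X.start = X.finish)
    (hY : Y.start = Y.finish) : HomEquiv (umul X Y) (umul Y X) := by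
  have key : ∀ {X Y : SigmaTree A}, X.start = X.finish → Y.start = Y.finish →
      Nonempty (Hom (umul X Y) (umul Y X)) := by
    intro X Y hX hY
    refine nonempty_hom_umul.2 ⟨Sum.inl Y.start, ⟨inrG Y X, ?_, ?_⟩, inlG Y X, rfl, ?_⟩
    · exact (glue_start Y X).trans (congrArg Sum.inl hY.symm)
    · exact (congrArg (glue Y X) hX.symm).trans
        ((glue_start Y X).trans (congrArg Sum.inl hY.symm))
    · exact (glue_start Y X).symm.trans (congrArg (glue Y X) hX)
  exact ⟨key hX hY, key hY hX⟩

theorem homEquiv_uplus_umul_self (X : SigmaTree A) : HomEquiv (umul (uplus X) X) X :=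
  ⟨nonempty_hom_umul.2 ⟨X.start, ⟨GHom.id _, rfl, rfl⟩, GHom.id _, rfl, rfl⟩,
    nonempty_hom_iff.2 ⟨inrG (uplus X) X, glue_start (uplus X) X, rfl⟩⟩

/-- Cancellation of `X` up to `X⁺`. A morphism `Z × X → Y × X` is also one from `Z × X⁺` to
`Y × X⁺`, since it respects the glueing points. -/
theorem IsLeftAdequate.nonempty_hom_umul_uplus {X Y Z : SigmaTree A} (hX : X.IsLeftAdequate)
    (hY : Y.IsLeftAdequate) (h : Nonempty (Hom (SigmaTree.umul Z X) (SigmaTree.umul Y X))) :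
    Nonempty (Hom (SigmaTree.umul Z (SigmaTree.uplus X))
      (SigmaTree.umul Y (SigmaTree.uplus X))) := by
  obtain ⟨f⟩ := h
  refine nonempty_hom_iff.2 ⟨f.toGHom, f.map_start, ?_⟩
  refine (congrArg f.vmap (glue_start Z X)).trans ?_
  exact (hX.vmap_inl_finish hY f).trans (glue_start Y X).symm

end SigmaTree

/-! ### The left adequate monoid of pruned left adequate trees -/

namespace LT

open SigmaTree

variable {A : Type u}

/-- The isomorphism type of the pruning of a left adequate tree. -/
noncomputable def ofTree {X : SigmaTree A} (hX : X.IsLeftAdequate) : LT A :=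
  ⟨⟨Quotient.mk _ (pruneRep X), pruneRep_isPruned X⟩, SigmaTree.IsLeftAdequate.pruneRep hX⟩

theorem ofTree_eq_iff {X Y : SigmaTree A} {hX : X.IsLeftAdequate} {hY : Y.IsLeftAdequate} :
    ofTree hX = ofTree hY ↔ HomEquiv X Y := by
  rw [← iso_pruneRep_iff]
  exact Subtype.ext_iff.trans (Subtype.ext_iff.trans Quotient.eq)

theorem eq_ofTree {X : SigmaTree A} (hX : X.IsLeftAdequate) (pX : X.IsPruned) :
    (⟨⟨Quotient.mk _ X, pX⟩, hX⟩ : LT A) = ofTree hX :=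
  Subtype.ext (Subtype.ext (Quotient.sound
    (pX.iso_of_homEquiv (pruneRep_isPruned X) (homEquiv_pruneRep X).symm)))

theorem exists_eq_ofTree (x : LT A) :
    ∃ (X : SigmaTree A) (hX : X.IsLeftAdequate), x = ofTree hX := by
  obtain ⟨⟨⟨X⟩, pX⟩, hX⟩ := x
  exact ⟨X, hX, eq_ofTree hX pX⟩

theorem base_isLeftAdequate (a : A) : (SigmaTree.base a).IsLeftAdequate := (LT.base a).2

theorem trivial_isLeftAdequate : (trivial A).IsLeftAdequate := (1 : LT A).2

theorem one_eq : (1 : LT A) = ofTree trivial_isLeftAdequate := eq_ofTree _ _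

theorem base_eq (a : A) : LT.base a = ofTree (base_isLeftAdequate a) := eq_ofTree _ _

theorem ofTree_mul {X Y : SigmaTree A} (hX : X.IsLeftAdequate) (hY : Y.IsLeftAdequate) :
    ofTree hX * ofTree hY = ofTree (hX.umul hY) := by
  change ofTree ((SigmaTree.IsLeftAdequate.pruneRep hX).umul
    (SigmaTree.IsLeftAdequate.pruneRep hY)) = _
  exact ofTree_eq_iff.2 ((homEquiv_pruneRep X).umul (homEquiv_pruneRep Y))

theorem uplus_isLeftAdequate {X : SigmaTree A} (hX : X.IsLeftAdequate) :
    (uplus X).IsLeftAdequate := hX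

theorem un_ofTree {X : SigmaTree A} (hX : X.IsLeftAdequate) :
    Alg210.un (ofTree hX) = ofTree (uplus_isLeftAdequate hX) := by
  change ofTree (uplus_isLeftAdequate (SigmaTree.IsLeftAdequate.pruneRep hX)) = _
  exact ofTree_eq_iff.2 (homEquiv_pruneRep X).uplus

theorem start_eq_finish_of_isIdempotentElem {X : SigmaTree A} {hX : X.IsLeftAdequate}
    (h : IsIdempotentElem (ofTree hX)) : X.start = X.finish := by
  rw [IsIdempotentElem, ofTree_mul, ofTree_eq_iff] at h
  exact hX.start_eq_finish_of_homEquiv h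

theorem un_mul_self (x : LT A) : Alg210.un x * x = x := by
  obtain ⟨X, hX, rfl⟩ := exists_eq_ofTree x
  rw [un_ofTree, ofTree_mul, ofTree_eq_iff]
  exact homEquiv_uplus_umul_self X

theorem mul_un_congr {x y z : LT A} (h : y * x = z * x) :
    y * Alg210.un x = z * Alg210.un x := by
  obtain ⟨X, hX, rfl⟩ := exists_eq_ofTree x
  obtain ⟨Y, hY, rfl⟩ := exists_eq_ofTree y
  obtain ⟨Z, hZ, rfl⟩ := exists_eq_ofTree z
  rw [ofTree_mul, ofTree_mul, ofTree_eq_iff] at h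
  rw [un_ofTree, ofTree_mul, ofTree_mul, ofTree_eq_iff]
  exact ⟨hX.nonempty_hom_umul_uplus hZ h.1, hX.nonempty_hom_umul_uplus hY h.2⟩

theorem isLeftAdequateMonoid (A : Type u) : IsLeftAdequateMonoid (LT A) := by
  have assoc : ∀ x y z : LT A, x * y * z = x * (y * z) := by
    intro x y z
    obtain ⟨X, hX, rfl⟩ := exists_eq_ofTree x
    obtain ⟨Y, hY, rfl⟩ := exists_eq_ofTree y
    obtain ⟨Z, hZ, rfl⟩ := exists_eq_ofTree z
    simp only [ofTree_mul, ofTree_eq_iff]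
    exact homEquiv_umul_assoc X Y Z
  refine ⟨⟨assoc, fun x => ?_, fun x => ?_⟩, fun e f he hf => ?_, fun x => ?_,
    fun x y z => ⟨mul_un_congr, fun h => ?_⟩⟩
  · obtain ⟨X, hX, rfl⟩ := exists_eq_ofTree x
    rw [one_eq, ofTree_mul, ofTree_eq_iff]
    exact homEquiv_trivial_umul X
  · obtain ⟨X, hX, rfl⟩ := exists_eq_ofTree x
    rw [one_eq, ofTree_mul, ofTree_eq_iff]
    exact homEquiv_umul_trivial X
  · obtain ⟨X, hX, rfl⟩ := exists_eq_ofTree e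
    obtain ⟨Y, hY, rfl⟩ := exists_eq_ofTree f
    rw [ofTree_mul, ofTree_mul, ofTree_eq_iff]
    exact homEquiv_umul_comm (start_eq_finish_of_isIdempotentElem he)
      (start_eq_finish_of_isIdempotentElem hf)
  · have h : Alg210.un (Alg210.un x) = Alg210.un x := by
      obtain ⟨X, hX, rfl⟩ := exists_eq_ofTree x
      rw [un_ofTree, un_ofTree]
      rfl
    have := un_mul_self (Alg210.un x)
    rwa [h] at this
  · rw [← un_mul_self x, ← assoc, ← assoc, h]

theorem base_injective : Function.Injective (LT.base : A → LT A) := by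
  intro a b h
  rw [base_eq, base_eq, ofTree_eq_iff] at h
  obtain ⟨⟨f⟩, -⟩ := h
  exact (f.label_emap ()).symm

end LT
end AdequateTrees

namespace AdequateTrees

/-! ### Identities in left adequate monoids -/

/-- Left adequate monoids as a type class extending `Monoid`. -/
class LeftAdequateMonoid (M : Type u) extends Alg210 M, Monoid M where
  idem_comm : ∀ e f : M, IsIdempotentElem e → IsIdempotentElem f → e * f = f * e
  un_idem : ∀ x : M, IsIdempotentElem (un x)
  un_rel : ∀ x : M, RStar x (un x)

/-- The class instance of an algebra that satisfies the axioms of left adequate monoids. It is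
reducible and keeps the given `Alg210` structure, so that statements transfer definitionally. -/
abbrev IsLeftAdequateMonoid.toLeftAdequateMonoid {M : Type u} [inst : Alg210 M]
    (h : IsLeftAdequateMonoid M) : LeftAdequateMonoid M where
  toAlg210 := inst
  mul_assoc := h.mul_assoc
  one_mul := h.one_mul
  mul_one := h.mul_one
  idem_comm := h.idem_comm
  un_idem := h.un_idem
  un_rel := h.un_rel

namespace LeftAdequateMonoid

open Alg210 (un)

variable {M : Type u} [LeftAdequateMonoid M]

theorem un_mul_self (x : M) : un x * x = x := by
  have := (un_rel x (un x) 1).2 (by rw [one_mul]; exact un_idem x)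
  rwa [one_mul] at this

theorem mul_un_eq {x y : M} (h : y * x = x) : y * un x = un x := by
  have := (un_rel x y 1).1 (by rwa [one_mul])
  rwa [one_mul] at this

/-- If `x⁺` is a left identity for `y` and `y⁺` is one for `x`, then `x⁺ = y⁺`. -/
theorem un_eq_un {x y : M} (h1 : un x * y = y) (h2 : un y * x = x) : un x = un y := by
  rw [← mul_un_eq h2, idem_comm _ _ (un_idem y) (un_idem x), mul_un_eq h1]

theorem un_of_isIdempotentElem {e : M} (he : IsIdempotentElem e) : un e = e := by
  have h : e * un e = un e := mul_un_eq he
  rw [← h, idem_comm _ _ he (un_idem e), un_mul_self]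

theorem mul_isIdempotentElem {e f : M} (he : IsIdempotentElem e) (hf : IsIdempotentElem f) :
    IsIdempotentElem (e * f) := by
  rw [IsIdempotentElem, mul_assoc, ← mul_assoc f, idem_comm f e hf he, mul_assoc, hf.eq,
    ← mul_assoc, he.eq]

theorem un_idem_mul {e : M} (he : IsIdempotentElem e) (x : M) : un (e * x) = e * un x := by
  have hg := mul_isIdempotentElem he (un_idem x)
  rw [← un_of_isIdempotentElem hg]
  refine un_eq_un ?_ ?_
  · rw [← mul_assoc]
    refine ((un_rel x _ _).1 ?_)
    rw [mul_assoc, un_mul_self]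
  · rw [un_of_isIdempotentElem hg, mul_assoc, ← mul_assoc (un x) e,
      idem_comm _ _ (un_idem x) he, mul_assoc e, un_mul_self, ← mul_assoc, he.eq]

theorem un_mul_un (x y : M) : un (x * un y) = un (x * y) := by
  refine un_eq_un ?_ ?_
  · rw [← mul_assoc]
    exact (un_rel y _ _).2 (by rw [mul_assoc, un_mul_self])
  · rw [← mul_assoc]
    exact (un_rel y _ _).1 (by rw [mul_assoc, un_mul_self])

theorem un_mul_un_mul (x y : M) : un x * un (x * y) = un (x * y) :=
  mul_un_eq (by rw [← mul_assoc, un_mul_self])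

end LeftAdequateMonoid

open LeftAdequateMonoid

/-- The idempotents of a left adequate monoid. -/
def Idem (M : Type u) [LeftAdequateMonoid M] : Type u := {e : M // IsIdempotentElem e}

namespace Idem

variable {M : Type u} [LeftAdequateMonoid M]

/-- The underlying element of the monoid. -/
def val (e : Idem M) : M := Subtype.val e

theorem ext {e f : Idem M} (h : e.val = f.val) : e = f := Subtype.ext h

theorem isIdempotentElem_val (e : Idem M) : IsIdempotentElem e.val := e.2

instance : CommMonoid (Idem M) where
  mul e f := ⟨e.1 * f.1, mul_isIdempotentElem e.2 f.2⟩
  one := ⟨1, mul_one 1⟩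
  mul_assoc _ _ _ := Subtype.ext (mul_assoc _ _ _)
  one_mul _ := Subtype.ext (one_mul _)
  mul_one _ := Subtype.ext (mul_one _)
  mul_comm e f := Subtype.ext (idem_comm _ _ e.2 f.2)

theorem val_mul (e f : Idem M) : (e * f).val = e.val * f.val := rfl

theorem val_one : (1 : Idem M).val = 1 := rfl

theorem mul_self (e : Idem M) : e * e = e := ext e.2

theorem un_val (e : Idem M) : Alg210.un e.val = e.val := un_of_isIdempotentElem e.2

theorem eq_of_mul_eq {e f : Idem M} (h : e * f = e) (h' : f * e = f) : e = f := by
  rw [← h, mul_comm, h']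

/-- The idempotent `(ae)⁺`: the contribution to a vertex of an edge labelled `a` that leads to a
subtree of value `e`. -/
def branch (a : M) (e : Idem M) : Idem M := ⟨Alg210.un (a * e.val), un_idem _⟩

theorem val_branch (a : M) (e : Idem M) : (branch a e).val = Alg210.un (a * e.val) := rfl

theorem branch_mono (a : M) {e f : Idem M} (h : e * f = e) :
    branch a e * branch a f = branch a e := by
  refine ext ?_
  rw [mul_comm, val_mul, val_branch, val_branch]
  rw [← h, mul_comm, val_mul, ← mul_assoc]
  exact un_mul_un_mul _ _

/-- In a trunk product, the contribution of an edge of the trunk is absorbed by the rest. -/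
theorem branch_mul (a : M) {e : Idem M} {m : M} (h : e.val * m = m) :
    (branch a e).val * (a * m) = a * m := by
  rw [← h, ← mul_assoc a, ← mul_assoc, val_branch, un_mul_self (a * e.val)]

theorem mul_finprod {ι : Type*} [Finite ι] {e : Idem M} {f : ι → Idem M}
    (h : ∀ i, e * f i = e) : e * ∏ᶠ i, f i = e := by
  refine finprod_induction (fun g => e * g = e) (mul_one e) (fun a b ha hb => ?_) h
  rw [← mul_assoc, ha, hb]

/-- Two families that differ in one place only have products with a common cofactor. -/
theorem exists_finprod_eq_mul {ι : Type*} [Finite ι] {f g : ι → Idem M} (i : ι)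
    (h : ∀ j, j ≠ i → f j = g j) : ∃ r, ∏ᶠ j, f j = r * f i ∧ ∏ᶠ j, g j = r * g i := by
  classical
  cases nonempty_fintype ι
  refine ⟨∏ j ∈ Finset.univ.erase i, f j, ?_, ?_⟩
  · rw [finprod_eq_prod_of_fintype, Finset.prod_erase_mul _ _ (Finset.mem_univ i)]
  · rw [finprod_eq_prod_of_fintype,
      Finset.prod_congr rfl fun j hj => h j (Finset.ne_of_mem_erase hj),
      Finset.prod_erase_mul _ _ (Finset.mem_univ i)]

theorem finprod_mul {ι : Type*} [Finite ι] (f : ι → Idem M) (i : ι) :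
    (∏ᶠ j, f j) * f i = ∏ᶠ j, f j := by
  obtain ⟨r, h, -⟩ := exists_finprod_eq_mul (f := f) (g := f) i fun _ _ => rfl
  rw [h, mul_assoc, mul_self]

theorem finprod_sum {ι κ : Type*} [Finite ι] [Finite κ] (f : ι ⊕ κ → Idem M) :
    ∏ᶠ j, f j = (∏ᶠ i, f (Sum.inl i)) * ∏ᶠ k, f (Sum.inr k) := by
  cases nonempty_fintype ι
  cases nonempty_fintype κ
  simp only [finprod_eq_prod_of_fintype, Fintype.prod_sum_type]

end Idem

/-! ### The value of a left adequate tree in a left adequate monoid -/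

namespace SigmaTree

open Idem (branch)

variable {A : Type u} {M : Type v} [LeftAdequateMonoid M] (χ : A → M)

open Classical in
/-- The value of the subtree of descendants of a vertex: the product of `(χ(a)e)⁺` over the
outgoing edges, with `a` the label of the edge and `e` the value of its target. -/
noncomputable def cone {X : SigmaTree A} (hX : X.IsLeftAdequate) : X.V → Idem M :=
  hX.wellFounded_flip_step.fix fun x ih => ∏ᶠ e : X.E,
    if h : X.src e = x then branch (χ (X.label e)) (ih (X.tgt e) ⟨e, h, rfl⟩) else 1

open Classical in
theorem cone_eq {X : SigmaTree A} (hX : X.IsLeftAdequate) (x : X.V) :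
    cone χ hX x = ∏ᶠ e : X.E,
      if X.src e = x then branch (χ (X.label e)) (cone χ hX (X.tgt e)) else 1 := by
  rw [cone, WellFounded.fix_eq]
  refine finprod_congr fun e => ?_
  split_ifs <;> rfl

/-- The value of a vertex is below the contribution of each of its outgoing edges. -/
theorem cone_mul_branch {X : SigmaTree A} (hX : X.IsLeftAdequate) (e : X.E) :
    cone χ hX (X.src e) * branch (χ (X.label e)) (cone χ hX (X.tgt e)) = cone χ hX (X.src e) := by
  classical
  have h := Idem.finprod_mul (fun f : X.E =>
    if X.src f = X.src e then branch (χ (X.label f)) (cone χ hX (X.tgt f)) else 1) e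
  rw [if_pos rfl, ← cone_eq] at h
  exact h

/-- The value of a vertex is the greatest idempotent below the contributions of its edges. -/
theorem mul_cone {X : SigmaTree A} (hX : X.IsLeftAdequate) {x : X.V} {g : Idem M}
    (h : ∀ e, X.src e = x → g * branch (χ (X.label e)) (cone χ hX (X.tgt e)) = g) :
    g * cone χ hX x = g := by
  classical
  rw [cone_eq]
  refine Idem.mul_finprod fun e => ?_
  split_ifs with he
  · exact h e he
  · exact mul_one g

/-- Morphisms decrease the values of vertices, in the order `g ≤ h ↔ g * h = g` on idempotents. -/
theorem cone_vmap_mul_cone {X Y : SigmaTree A} (hX : X.IsLeftAdequate) (hY : Y.IsLeftAdequate)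
    (f : Hom X Y) (x : X.V) : cone χ hY (f.vmap x) * cone χ hX x = cone χ hY (f.vmap x) := by
  induction x using hX.wellFounded_flip_step.induction with
  | _ x ih =>
    refine mul_cone χ hX fun e he => ?_
    have h1 := cone_mul_branch χ hY (f.emap e)
    have h2 := Idem.branch_mono (χ (X.label e)) (ih (X.tgt e) ⟨e, he, rfl⟩)
    rw [f.src_emap, f.tgt_emap, f.label_emap, he] at h1
    rw [← h1, mul_assoc, h2]

/-- `Trunk χ hX x m` says that the end vertex can be reached from `x` and that `m` is the product,
along the directed path from `x` to the end vertex, of the values of the vertices and of the images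
of the labels. -/
inductive Trunk {X : SigmaTree A} (hX : X.IsLeftAdequate) : X.V → M → Prop
  | finish : Trunk hX X.finish (cone χ hX X.finish).val
  | cons (e : X.E) {m : M} : Trunk hX (X.tgt e) m →
      Trunk hX (X.src e) ((cone χ hX (X.src e)).val * (χ (X.label e) * m))

namespace Trunk

variable {χ} {X : SigmaTree A} {hX : X.IsLeftAdequate} {x : X.V} {m : M}

theorem reach (h : Trunk χ hX x m) : X.Reach x X.finish := by
  induction h with
  | finish => exact .refl
  | cons e _ ih => exact .head ⟨e, rfl, rfl⟩ ih

theorem exists_of_reach (h : X.Reach x X.finish) : ∃ m, Trunk χ hX x m := by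
  induction h using Relation.ReflTransGen.head_induction_on with
  | refl => exact ⟨_, .finish⟩
  | head hs _ ih =>
    obtain ⟨e, rfl, rfl⟩ := hs
    obtain ⟨m, hm⟩ := ih
    exact ⟨_, .cons e hm⟩

theorem eq_of_finish (h : Trunk χ hX x m) (hx : x = X.finish) : m = (cone χ hX x).val := by
  cases h with
  | finish => rfl
  | cons e h => exact absurd (hx ▸ h.reach) (hX.not_reach_tgt_src e)

theorem exists_of_src {e : X.E} (h : Trunk χ hX (X.src e) m) (he : X.Reach (X.tgt e) X.finish) :
    ∃ m', Trunk χ hX (X.tgt e) m' ∧ m = (cone χ hX (X.src e)).val * (χ (X.label e) * m') := by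
  generalize hx : X.src e = x at h
  cases h with
  | finish => exact absurd (hx ▸ he) (hX.not_reach_tgt_src e)
  | cons f h =>
    obtain rfl := hX.edge_unique hx he h.reach
    exact ⟨_, h, rfl⟩

theorem unique {m' : M} (h : Trunk χ hX x m) (h' : Trunk χ hX x m') : m = m' := by
  induction h generalizing m' with
  | finish => exact (h'.eq_of_finish rfl).symm
  | cons e h ih =>
    obtain ⟨m'', h'', rfl⟩ := h'.exists_of_src h.reach
    rw [ih h'']

theorem cone_mul (h : Trunk χ hX x m) : (cone χ hX x).val * m = m := by
  cases h with
  | finish => exact (cone χ hX _).isIdempotentElem_val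
  | cons e h => rw [← mul_assoc, (cone χ hX _).isIdempotentElem_val.eq]

/-- The value of a vertex of the trunk is the `+` of the trunk product from there on. -/
theorem un_eq (h : Trunk χ hX x m) : Alg210.un m = (cone χ hX x).val := by
  induction h with
  | finish => exact Idem.un_val _
  | cons e _ ih =>
    rw [un_idem_mul (cone χ hX (X.src e)).isIdempotentElem_val, ← un_mul_un (χ (X.label e)), ih]
    exact congrArg Idem.val (cone_mul_branch χ hX e)

/-- Morphisms `X → Y` and `Y → X` transport trunk products: by rigidity their composite fixes the
vertices of the trunk, so that the values of these, which decrease along both morphisms, are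
preserved. -/
theorem map {Y : SigmaTree A} {hY : Y.IsLeftAdequate} (h : Trunk χ hX x m) (f : Hom X Y)
    (g : Hom Y X) : Trunk χ hY (f.vmap x) m := by
  have key : ∀ {x}, X.Reach x X.finish → cone χ hX x = cone χ hY (f.vmap x) := by
    intro x hx
    have hfix : g.vmap (f.vmap x) = x :=
      LDigraph.GHom.eq_of_reach hX.tgt_injective (g.comp f).toGHom (Hom.id X).toGHom hx
        (g.comp f).map_finish
    have h1 := cone_vmap_mul_cone χ hX hY f x
    have h2 := cone_vmap_mul_cone χ hY hX g (f.vmap x)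
    rw [hfix] at h2
    exact Idem.eq_of_mul_eq h2 h1
  induction h with
  | finish =>
    rw [key .refl, f.map_finish]
    exact .finish
  | cons e h ih =>
    rw [key (.head ⟨e, rfl, rfl⟩ h.reach), ← f.src_emap, ← f.label_emap]
    rw [← f.tgt_emap] at ih
    exact .cons _ ih

end Trunk

/-- The value of a left adequate tree: the product along the trunk, which is the directed path from
the start vertex to the end vertex. -/
noncomputable def value {X : SigmaTree A} (hX : X.IsLeftAdequate) : M :=
  (Trunk.exists_of_reach (χ := χ) (hX := hX) X.path).choose

theorem trunk_value {X : SigmaTree A} (hX : X.IsLeftAdequate) : Trunk χ hX X.start (value χ hX) :=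
  (Trunk.exists_of_reach (χ := χ) (hX := hX) X.path).choose_spec

theorem value_eq_of_homEquiv {X Y : SigmaTree A} {hX : X.IsLeftAdequate} {hY : Y.IsLeftAdequate}
    (h : HomEquiv X Y) : value χ hX = value χ hY := by
  obtain ⟨⟨f⟩, ⟨g⟩⟩ := h
  have := (trunk_value χ hX).map (hY := hY) f g
  rw [f.map_start] at this
  exact this.unique (trunk_value χ hY)

theorem value_uplus {X : SigmaTree A} (hX : X.IsLeftAdequate) :
    value χ (LT.uplus_isLeftAdequate hX) = Alg210.un (value χ hX) := by
  rw [(trunk_value χ hX).un_eq]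
  exact (trunk_value χ (LT.uplus_isLeftAdequate hX)).eq_of_finish rfl

theorem value_trivial : value χ (LT.trivial_isLeftAdequate (A := A)) = 1 := by
  rw [(trunk_value χ (LT.trivial_isLeftAdequate (A := A))).eq_of_finish rfl, cone_eq]
  have : IsEmpty (trivial A).E := inferInstanceAs (IsEmpty Empty)
  rw [finprod_of_isEmpty, Idem.val_one]

theorem value_base (a : A) : value χ (LT.base_isLeftAdequate a) = χ a := by
  classical
  have h1 : cone χ (LT.base_isLeftAdequate a) (base a).finish = 1 := by
    rw [cone_eq]
    exact finprod_eq_one_of_forall_eq_one fun e => if_neg fun h => Bool.false_ne_true h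
  have h2 : cone χ (LT.base_isLeftAdequate a) (base a).start = branch (χ a) 1 := by
    rw [cone_eq]
    have : Unique (base a).E := inferInstanceAs (Unique Unit)
    rw [finprod_unique, ← h1]
    exact if_pos rfl
  have h : Trunk χ (LT.base_isLeftAdequate a) (base a).start
      ((cone χ (LT.base_isLeftAdequate a) (base a).start).val *
        (χ a * (cone χ (LT.base_isLeftAdequate a) (base a).finish).val)) :=
    .cons (X := base a) () .finish
  rw [(trunk_value χ (LT.base_isLeftAdequate a)).unique h, h1, h2, Idem.val_branch, Idem.val_one,
    mul_one, un_mul_self (χ a)]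

/-! ### The value of a product -/

theorem inlG_injective (X Y : SigmaTree A) : Function.Injective (inlG X Y).vmap :=
  Sum.inl_injective

theorem inrG_injective (X Y : SigmaTree A) : Function.Injective (inrG X Y).vmap :=
  glue_injective X Y

theorem inrG_start (X Y : SigmaTree A) :
    (inrG X Y).vmap Y.start = (inlG X Y).vmap X.finish := glue_start X Y

theorem eq_start_of_inrG_eq_inlG {X Y : SigmaTree A} {y : Y.V} {x : X.V}
    (h : (inrG X Y).vmap y = (inlG X Y).vmap x) : y = Y.start := eq_start_of_glue_eq_inl h

section Product

variable {X Y : SigmaTree A} (hX : X.IsLeftAdequate) (hY : Y.IsLeftAdequate)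

open Classical in
theorem cone_umul (z : (umul X Y).V) : cone χ (hX.umul hY) z =
    (∏ᶠ e : X.E, if (inlG X Y).vmap (X.src e) = z then
      branch (χ (X.label e)) (cone χ (hX.umul hY) ((inlG X Y).vmap (X.tgt e))) else 1) *
    ∏ᶠ e : Y.E, if (inrG X Y).vmap (Y.src e) = z then
      branch (χ (Y.label e)) (cone χ (hX.umul hY) ((inrG X Y).vmap (Y.tgt e))) else 1 := by
  rw [cone_eq]
  exact Idem.finprod_sum (ι := X.E) (κ := Y.E) _

theorem cone_umul_inrG {y : Y.V} (hy : y ≠ Y.start) :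
    cone χ (hX.umul hY) ((inrG X Y).vmap y) = cone χ hY y := by
  classical
  induction y using hY.wellFounded_flip_step.induction with
  | _ y ih =>
    rw [cone_umul χ hX hY, cone_eq χ hY, finprod_eq_one_of_forall_eq_one, one_mul]
    · refine finprod_congr fun e => ?_
      simp only [(inrG_injective X Y).eq_iff]
      split_ifs with he
      · rw [ih _ ⟨e, he, rfl⟩ (hY.tgt_ne_start e)]
      · rfl
    · exact fun e => if_neg fun h => hy (eq_start_of_inrG_eq_inlG h.symm)

open Classical in
theorem cone_umul_inlG (x : X.V) : cone χ (hX.umul hY) ((inlG X Y).vmap x) =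
    (∏ᶠ e : X.E, if X.src e = x then
      branch (χ (X.label e)) (cone χ (hX.umul hY) ((inlG X Y).vmap (X.tgt e))) else 1) *
    if x = X.finish then cone χ hY Y.start else 1 := by
  rw [cone_umul χ hX hY]
  congr 1
  · simp only [(inlG_injective X Y).eq_iff]
  · split_ifs with hx
    · rw [hx, ← inrG_start X Y, cone_eq]
      refine finprod_congr fun e => ?_
      simp only [(inrG_injective X Y).eq_iff, cone_umul_inrG χ hX hY (hY.tgt_ne_start e)]
    · refine finprod_eq_one_of_forall_eq_one fun e => if_neg fun h => hx ?_
      rw [eq_start_of_inrG_eq_inlG h, inrG_start] at h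
      exact (inlG_injective X Y h).symm

theorem cone_umul_inlG_of_not_reach {x : X.V} (hx : ¬ X.Reach x X.finish) :
    cone χ (hX.umul hY) ((inlG X Y).vmap x) = cone χ hX x := by
  classical
  induction x using hX.wellFounded_flip_step.induction with
  | _ x ih =>
    have hne : x ≠ X.finish := fun h => hx (by rw [h]; exact .refl)
    rw [cone_umul_inlG χ hX hY, cone_eq χ hX, if_neg hne, mul_one]
    refine finprod_congr fun e => ?_
    split_ifs with he
    · rw [ih _ ⟨e, he, rfl⟩ fun h => hx (.head ⟨e, he, rfl⟩ h)]
    · rfl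

/-- The glueing point has the outgoing edges of the end vertex of `X` and of the start vertex of
`Y`, so that its value is the product of theirs. -/
theorem cone_umul_inlG_finish : cone χ (hX.umul hY) ((inlG X Y).vmap X.finish) =
    cone χ hX X.finish * cone χ hY Y.start := by
  classical
  rw [cone_umul_inlG χ hX hY, if_pos rfl, cone_eq χ hX]
  congr 1
  refine finprod_congr fun e => ?_
  split_ifs with he
  · rw [cone_umul_inlG_of_not_reach χ hX hY fun h => hX.not_reach_tgt_src e (by rwa [he])]
  · rfl

variable {χ} {hX hY}

theorem Trunk.cons_inlG (e : X.E) {m : M}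
    (h : Trunk χ (hX.umul hY) ((inlG X Y).vmap (X.tgt e)) m) :
    Trunk χ (hX.umul hY) ((inlG X Y).vmap (X.src e))
      ((cone χ (hX.umul hY) ((inlG X Y).vmap (X.src e))).val * (χ (X.label e) * m)) :=
  .cons (hX := hX.umul hY) ((inlG X Y).emap e) h

theorem Trunk.cons_inrG (e : Y.E) {m : M}
    (h : Trunk χ (hX.umul hY) ((inrG X Y).vmap (Y.tgt e)) m) :
    Trunk χ (hX.umul hY) ((inrG X Y).vmap (Y.src e))
      ((cone χ (hX.umul hY) ((inrG X Y).vmap (Y.src e))).val * (χ (Y.label e) * m)) :=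
  .cons (hX := hX.umul hY) ((inrG X Y).emap e) h

theorem Trunk.finish_inrG : Trunk χ (hX.umul hY) ((inrG X Y).vmap Y.finish)
    (cone χ (hX.umul hY) ((inrG X Y).vmap Y.finish)).val := .finish

theorem Trunk.inrG {y : Y.V} {m : M} (h : Trunk χ hY y m) (hy : y ≠ Y.start) :
    Trunk χ (hX.umul hY) ((inrG X Y).vmap y) m := by
  induction h with
  | finish =>
    rw [← cone_umul_inrG χ hX hY hy]
    exact .finish_inrG (hX := hX) (hY := hY)
  | cons e _ ih =>
    rw [← cone_umul_inrG χ hX hY hy]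
    exact .cons_inrG (hX := hX) (hY := hY) e (ih (hY.tgt_ne_start e))

theorem Trunk.inlG_finish {y : Y.V} {m : M} (h : Trunk χ hY y m) (hy : y = Y.start) :
    Trunk χ (hX.umul hY) ((inlG X Y).vmap X.finish) ((cone χ hX X.finish).val * m) := by
  cases h with
  | finish =>
    have := Trunk.finish_inrG (χ := χ) (hX := hX) (hY := hY)
    rw [hy, inrG_start, cone_umul_inlG_finish, Idem.val_mul] at this
    rwa [hy]
  | cons e h =>
    have := Trunk.cons_inrG (hX := hX) (hY := hY) e (h.inrG (hX := hX) (hY.tgt_ne_start e))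
    rw [hy, inrG_start, cone_umul_inlG_finish, Idem.val_mul, mul_assoc] at this
    rwa [hy]

/-- Trunk products multiply. The value of a vertex of the trunk of `X` changes by the inclusion
into `X × Y`, but only in the factor that belongs to the next edge of the trunk, which is absorbed
by the rest of the trunk product. -/
theorem Trunk.umul {x : X.V} {m m' : M} (h : Trunk χ hX x m) (h' : Trunk χ hY Y.start m') :
    Trunk χ (hX.umul hY) ((inlG X Y).vmap x) (m * m') := by
  classical
  induction h with
  | finish => exact h'.inlG_finish rfl
  | @cons e m h ih =>
    have hne : X.src e ≠ X.finish := fun hf => hX.not_reach_tgt_src e (by rw [hf]; exact h.reach)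
    obtain ⟨r, h1, h2⟩ := Idem.exists_finprod_eq_mul (M := M) (f := fun f : X.E =>
        if X.src f = X.src e then branch (χ (X.label f)) (cone χ hX (X.tgt f)) else 1)
      (g := fun f : X.E => if X.src f = X.src e then
        branch (χ (X.label f)) (cone χ (hX.umul hY) ((inlG X Y).vmap (X.tgt f))) else 1) e
      fun f hf => by
        split_ifs with he
        · rw [cone_umul_inlG_of_not_reach χ hX hY
            fun hr => hf (hX.edge_unique he hr h.reach)]
        · rfl
    rw [if_pos rfl, ← cone_eq] at h1
    have h3 := cone_umul_inlG χ hX hY (X.src e)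
    rw [if_neg hne, mul_one, h2, if_pos rfl] at h3
    have := Trunk.cons_inlG (hX := hX) (hY := hY) e ih
    rw [h3, Idem.val_mul, mul_assoc, Idem.branch_mul _ ih.cone_mul] at this
    rw [h1, Idem.val_mul, mul_assoc r.val, Idem.branch_mul _ h.cone_mul, mul_assoc, mul_assoc]
    exact this

variable (χ) (hX) (hY)

theorem value_umul : value χ (hX.umul hY) = value χ hX * value χ hY :=
  (trunk_value χ (hX.umul hY)).unique ((trunk_value χ hX).umul (trunk_value χ hY))

end Product

end SigmaTree
end AdequateTrees

namespace AdequateTrees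

open LDigraph (GHom)

open SigmaTree

open LeftAdequateMonoid

/-! ### Trees are determined by their values -/

/-- A morphism out of a left adequate tree can be built edge by edge, starting at the start vertex
and maintaining an invariant `P`. -/
theorem SigmaTree.IsLeftAdequate.exists_gHom {A : Type u} {X : SigmaTree A}
    (hX : X.IsLeftAdequate) {D : LDigraph A} (P : X.V → D.V → Prop) {z : D.V} (h0 : P X.start z)
    (hstep : ∀ e z, P (X.src e) z →
      ∃ e', D.src e' = z ∧ D.label e' = X.label e ∧ P (X.tgt e) (D.tgt e')) :
    ∃ f : GHom X.toLDigraph D, f.vmap X.start = z ∧ ∀ x, P x (f.vmap x) := by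
  classical
  choose next hsrc hlabel hP using hstep
  have hstart : ∀ x, ¬ (∃ e, X.tgt e = x) → X.start = x := fun x hx => by
    rcases Relation.ReflTransGen.cases_tail (hX x) with h | ⟨y, -, e, -, he⟩
    · exact h.symm
    · exact absurd ⟨e, he⟩ hx
  let F : ∀ x, (∀ y, X.Step y x → {z // P y z}) → {z // P x z} := fun x ih =>
    if h : ∃ e, X.tgt e = x then
      ⟨D.tgt (next h.choose (ih _ ⟨h.choose, rfl, h.choose_spec⟩).1
        (ih _ ⟨h.choose, rfl, h.choose_spec⟩).2),
        Eq.subst (motive := fun y => P y _) h.choose_spec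
          (hP h.choose _ (ih _ ⟨h.choose, rfl, h.choose_spec⟩).2)⟩
    else ⟨z, hstart x h ▸ h0⟩
  let G : ∀ x, {z // P x z} := hX.wellFounded_step.fix F
  have hG : ∀ x, G x = F x fun y _ => G y := fun x => WellFounded.fix_eq _ _ _
  have hG_start : (G X.start).1 = z := by
    rw [hG]
    have hn : ¬ ∃ e, X.tgt e = X.start := fun ⟨e, he⟩ => hX.tgt_ne_start e he
    simp only [F, dif_neg hn]
  have hG_tgt : ∀ e, (G (X.tgt e)).1 = D.tgt (next e (G (X.src e)).1 (G (X.src e)).2) := by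
    intro e
    have hp : ∃ f, X.tgt f = X.tgt e := ⟨e, rfl⟩
    rw [hG]
    simp only [F, dif_pos hp]
    have aux : ∀ f, f = e → D.tgt (next f (G (X.src f)).1 (G (X.src f)).2) =
        D.tgt (next e (G (X.src e)).1 (G (X.src e)).2) := by
      rintro _ rfl
      rfl
    exact aux _ (hX.tgt_injective hp.choose_spec)
  exact ⟨⟨fun x => (G x).1, fun e => next e (G (X.src e)).1 (G (X.src e)).2,
    fun e => hsrc _ _ _, fun e => (hG_tgt e).symm, fun e => hlabel _ _ _⟩, hG_start,
    fun x => (G x).2⟩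

namespace LT

variable {A : Type u}

noncomputable instance : LeftAdequateMonoid (LT A) :=
  (isLeftAdequateMonoid A).toLeftAdequateMonoid

/-- `Maps x z z'` says that a tree representing `x` has a morphism into `D` that takes the start
vertex to `z` and the end vertex to `z'`. This represents `LT¹(Σ)` by binary relations on `D`. -/
def Maps {D : LDigraph A} (x : LT A) (z z' : D.V) : Prop :=
  ∃ (X : SigmaTree A) (hX : X.IsLeftAdequate), x = ofTree hX ∧
    ∃ f : GHom X.toLDigraph D, f.vmap X.start = z ∧ f.vmap X.finish = z'

section Maps

variable {D : LDigraph A} {z z' : D.V}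

theorem maps_ofTree {X : SigmaTree A} {hX : X.IsLeftAdequate} : Maps (ofTree hX) z z' ↔
    ∃ f : GHom X.toLDigraph D, f.vmap X.start = z ∧ f.vmap X.finish = z' := by
  refine ⟨?_, fun h => ⟨X, hX, rfl, h⟩⟩
  rintro ⟨Y, hY, h, f, h1, h2⟩
  obtain ⟨⟨g⟩, -⟩ := ofTree_eq_iff.1 h
  exact ⟨f.comp g.toGHom, (congrArg f.vmap g.map_start).trans h1,
    (congrArg f.vmap g.map_finish).trans h2⟩

theorem maps_mul {x y : LT A} : Maps (x * y) z z' ↔ ∃ t, Maps x z t ∧ Maps y t z' := by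
  obtain ⟨X, hX, rfl⟩ := exists_eq_ofTree x
  obtain ⟨Y, hY, rfl⟩ := exists_eq_ofTree y
  rw [ofTree_mul]
  simp only [maps_ofTree]
  exact exists_umul_gHom_iff

theorem maps_one : Maps (1 : LT A) z z :=
  one_eq (A := A) ▸ maps_ofTree.2 ⟨trivialG z, rfl, rfl⟩

theorem maps_un {x : LT A} : Maps (Alg210.un x) z z' ↔ z = z' ∧ ∃ t, Maps x z t := by
  obtain ⟨X, hX, rfl⟩ := exists_eq_ofTree x
  rw [un_ofTree]
  simp only [maps_ofTree]
  constructor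
  · rintro ⟨f, h1, h2⟩
    exact ⟨h1.symm.trans h2, f.vmap X.finish, f, h1, rfl⟩
  · rintro ⟨rfl, t, f, h1, -⟩
    exact ⟨f, h1, h1⟩

theorem maps_base {a : A} :
    Maps (LT.base a) z z' ↔ ∃ e, D.src e = z ∧ D.tgt e = z' ∧ D.label e = a := by
  rw [base_eq, maps_ofTree]
  constructor
  · rintro ⟨f, h1, h2⟩
    exact ⟨f.emap (), (f.src_emap ()).trans h1, (f.tgt_emap ()).trans h2, f.label_emap ()⟩
  · rintro ⟨e, rfl, rfl, rfl⟩
    exact ⟨baseG e, rfl, rfl⟩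

/-- Idempotents act as partial identities, since `e = e⁺`. -/
theorem eq_of_maps_val {e : Idem (LT A)} (h : Maps e.val z z') : z = z' := by
  rw [← Idem.un_val] at h
  exact (maps_un.1 h).1

end Maps

/-- A tree has a morphism to wherever its value in `LT¹(Σ)` can be mapped. The invariant of the
construction is that the value of a vertex, and for a vertex on the trunk also the trunk product
from there on, can be mapped to the image of the vertex. -/
theorem exists_gHom_of_maps_value {X : SigmaTree A} {hX : X.IsLeftAdequate} {D : LDigraph A}
    {z z' : D.V} (h : Maps (value LT.base hX) z z') :
    ∃ f : GHom X.toLDigraph D, f.vmap X.start = z ∧ f.vmap X.finish = z' := by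
  have htrunk : ∀ m, Trunk LT.base hX X.start m → Maps m z z' :=
    fun m hm => hm.unique (trunk_value _ hX) ▸ h
  have hcone : ∀ {x : X.V} {m : LT A} {t : D.V}, Trunk LT.base hX x m → Maps m t z' →
      Maps (cone LT.base hX x).val t t := by
    intro x m t hm hmt
    rw [← hm.cone_mul] at hmt
    obtain ⟨t', h1, -⟩ := maps_mul.1 hmt
    obtain rfl := eq_of_maps_val h1
    exact h1
  obtain ⟨f, h1, h2⟩ := hX.exists_gHom (D := D) (fun x t => Maps (cone LT.base hX x).val t t ∧
    ∀ m, Trunk LT.base hX x m → Maps m t z') ⟨hcone (trunk_value _ hX) h, htrunk⟩ (by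
    rintro e t ⟨h1, h2⟩
    -- An edge of the trunk has to follow the trunk product, as only this leads on to `z'`; for any
    -- other edge a suitable image is provided by its contribution to the value of its source.
    by_cases hm : ∃ m, Trunk LT.base hX (X.tgt e) m
    · obtain ⟨m, hm⟩ := hm
      obtain ⟨t', h3, h4⟩ := maps_mul.1 (h2 _ (.cons e hm))
      obtain rfl := eq_of_maps_val h3
      obtain ⟨s, h5, h6⟩ := maps_mul.1 h4
      obtain ⟨e', he1, rfl, he2⟩ := maps_base.1 h5
      exact ⟨e', he1, he2, hcone hm h6, fun m' hm' => hm'.unique hm ▸ h6⟩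
    · rw [← cone_mul_branch, Idem.val_mul] at h1
      obtain ⟨t', -, h3⟩ := maps_mul.1 h1
      obtain ⟨rfl, s, h4⟩ := maps_un.1 h3
      obtain ⟨r, h5, h6⟩ := maps_mul.1 h4
      obtain ⟨e', he1, rfl, he2⟩ := maps_base.1 h5
      obtain rfl := eq_of_maps_val h6
      exact ⟨e', he1, he2, h6, fun m' hm' => absurd ⟨m', hm'⟩ hm⟩)
  exact ⟨f, h1, eq_of_maps_val ((h2 X.finish).2 _ .finish)⟩

theorem maps_cone {X : SigmaTree A} (hX : X.IsLeftAdequate) (x : X.V) :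
    Maps (D := X.toLDigraph) (cone LT.base hX x).val x x := by
  classical
  induction x using hX.wellFounded_flip_step.induction with
  | _ x ih =>
    rw [cone_eq]
    refine finprod_induction (fun e : Idem (LT A) => Maps (D := X.toLDigraph) e.val x x) maps_one
      (fun e f he hf => maps_mul.2 ⟨x, he, hf⟩) fun e => ?_
    split_ifs with he
    · exact maps_un.2 ⟨rfl, X.tgt e, maps_mul.2 ⟨X.tgt e, maps_base.2 ⟨e, he, rfl, rfl⟩,
        ih _ ⟨e, he, rfl⟩⟩⟩
    · exact maps_one

theorem maps_of_trunk {X : SigmaTree A} {hX : X.IsLeftAdequate} {x : X.V} {m : LT A}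
    (h : Trunk LT.base hX x m) : Maps (D := X.toLDigraph) m x X.finish := by
  induction h with
  | finish => exact maps_cone hX _
  | cons e _ ih =>
    exact maps_mul.2 ⟨_, maps_cone hX _, maps_mul.2 ⟨_, maps_base.2 ⟨e, rfl, rfl, rfl⟩, ih⟩⟩

/-- The value of a tree with respect to the base trees is the class of the tree itself. In
particular the base trees generate `LT¹(Σ)`. -/
theorem value_base_eq_ofTree {X : SigmaTree A} (hX : X.IsLeftAdequate) :
    value LT.base hX = ofTree hX := by
  obtain ⟨T, hT, h⟩ := exists_eq_ofTree (value LT.base hX)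
  rw [h, ofTree_eq_iff]
  constructor
  · have := maps_of_trunk (trunk_value LT.base hX)
    rw [h, maps_ofTree] at this
    exact nonempty_hom_iff.2 this
  · refine nonempty_hom_iff.2 (exists_gHom_of_maps_value (hX := hX) ?_)
    rw [h, maps_ofTree]
    exact ⟨GHom.id _, rfl, rfl⟩

/-! ### Freeness of the monoid of left adequate trees -/

section Lift

variable {M : Type v} [LeftAdequateMonoid M]

/-- The morphism from `LT¹(Σ)` that extends a function on the letters. -/
noncomputable def lift (χ : A → M) (x : LT A) : M := value χ (exists_eq_ofTree x).choose_spec.choose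

theorem lift_ofTree (χ : A → M) {X : SigmaTree A} (hX : X.IsLeftAdequate) :
    lift χ (ofTree hX) = value χ hX :=
  value_eq_of_homEquiv χ
    (ofTree_eq_iff.1 (exists_eq_ofTree (ofTree hX)).choose_spec.choose_spec).symm

theorem isMorphism_lift (χ : A → M) : IsMorphism (lift χ) where
  map_mul x y := by
    obtain ⟨X, hX, rfl⟩ := exists_eq_ofTree x
    obtain ⟨Y, hY, rfl⟩ := exists_eq_ofTree y
    rw [ofTree_mul, lift_ofTree, lift_ofTree, lift_ofTree, value_umul]
  map_one := by rw [one_eq, lift_ofTree, value_trivial]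
  map_un x := by
    obtain ⟨X, hX, rfl⟩ := exists_eq_ofTree x
    rw [un_ofTree, lift_ofTree, lift_ofTree, value_uplus]

theorem lift_base (χ : A → M) (a : A) : lift χ (LT.base a) = χ a := by
  rw [base_eq, lift_ofTree, value_base]

theorem _root_.AdequateTrees.IsMorphism.map_cone {f : LT A → M} (hf : IsMorphism f)
    {X : SigmaTree A} (hX : X.IsLeftAdequate) (x : X.V) :
    f (cone LT.base hX x).val = (cone (f ∘ LT.base) hX x).val := by
  classical
  induction x using hX.wellFounded_flip_step.induction with
  | _ x ih =>
    cases nonempty_fintype X.E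
    rw [cone_eq, cone_eq, finprod_eq_prod_of_fintype, finprod_eq_prod_of_fintype]
    refine Finset.prod_hom_rel (r := fun (e : Idem (LT A)) (e' : Idem M) => f e.val = e'.val)
      hf.map_one fun e g g' hg => ?_
    rw [Idem.val_mul, Idem.val_mul, ← hg]
    refine (hf.map_mul _ _).trans ?_
    congr 1
    split_ifs with he
    · refine (hf.map_un _).trans (congrArg Alg210.un ?_)
      refine (hf.map_mul _ _).trans ?_
      rw [ih _ ⟨e, he, rfl⟩]
      rfl
    · exact hf.map_one

theorem _root_.AdequateTrees.IsMorphism.map_trunk {f : LT A → M} (hf : IsMorphism f)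
    {X : SigmaTree A} {hX : X.IsLeftAdequate} {x : X.V} {m : LT A} (h : Trunk LT.base hX x m) :
    Trunk (f ∘ LT.base) hX x (f m) := by
  induction h with
  | finish =>
    rw [hf.map_cone]
    exact .finish
  | cons e _ ih =>
    have := Trunk.cons e ih
    rw [← hf.map_cone] at this
    exact (hf.map_mul _ _).trans (congrArg _ (hf.map_mul _ _)) ▸ this

theorem eq_lift {f : LT A → M} (hf : IsMorphism f) : f = lift (f ∘ LT.base) := by
  funext x
  obtain ⟨X, hX, rfl⟩ := exists_eq_ofTree x
  rw [lift_ofTree, ← value_base_eq_ofTree hX]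
  exact (hf.map_trunk (trunk_value LT.base hX)).unique (trunk_value _ hX)

end Lift

theorem isFreeLeftAdequateMonoidOn (A : Type u) :
    IsFreeLeftAdequateMonoidOn.{max 1 u, w} (LT A) (Set.range LT.base) where
  mem := isLeftAdequateMonoid A
  exists_unique_extension M _ hM χ := by
    let := hM.toLeftAdequateMonoid
    refine ⟨lift fun a => χ ⟨LT.base a, a, rfl⟩, ⟨isMorphism_lift _, ?_⟩, ?_⟩
    · rintro ⟨_, a, rfl⟩
      exact lift_base _ a
    · rintro f ⟨hf, hχ⟩
      refine (eq_lift hf).trans (congrArg lift (funext fun a => ?_))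
      exact hχ ⟨LT.base a, a, rfl⟩

end LT
end AdequateTrees

namespace AdequateTrees

open LDigraph (GHom)

open SigmaTree

/-! ### Reversal of trees -/

namespace LDigraph

variable {A : Type u}

/-- The digraph with all edges reversed. -/
def rev (D : LDigraph A) : LDigraph A := { D with src := D.tgt, tgt := D.src }

theorem rev_underlying (D : LDigraph A) : D.rev.underlying = D.underlying := by
  have h : ∀ x y, D.rev.Step x y ↔ D.Step y x := fun x y =>
    ⟨fun ⟨e, h1, h2⟩ => ⟨e, h2, h1⟩, fun ⟨e, h1, h2⟩ => ⟨e, h2, h1⟩⟩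
  ext x y
  exact adj_iff.trans (Iff.trans (and_congr_right fun _ =>
    (or_congr (h x y) (h y x)).trans or_comm) (adj_iff (D := D) (x := x) (y := y)).symm)

theorem IsTree.rev {D : LDigraph A} (h : D.IsTree) : D.rev.IsTree where
  no_loop e := (h.no_loop e).symm
  no_multi e f hef := h.no_multi e f (Sym2.eq_swap.trans (hef.trans Sym2.eq_swap))
  tree := by rw [rev_underlying]; exact h.tree

theorem Reach.rev {D : LDigraph A} {x y : D.V} (h : D.Reach x y) : D.rev.Reach y x := by
  induction h with
  | refl => exact .refl
  | tail _ hs ih =>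
    obtain ⟨e, h1, h2⟩ := hs
    exact .head ⟨e, h2, h1⟩ ih

end LDigraph

namespace SigmaTree

variable {A : Type u}

/-- The tree with all edges reversed and the start and end vertices exchanged. -/
def rev (X : SigmaTree A) : SigmaTree A where
  toLDigraph := X.toLDigraph.rev
  finV := X.finV
  finE := X.finE
  isTree := X.isTree.rev
  start := X.finish
  finish := X.start
  path := X.path.rev

/-- Reversal of a morphism. -/
def Hom.rev {X Y : SigmaTree A} (f : Hom X Y) : Hom X.rev Y.rev :=
  ⟨f.vmap, f.emap, f.tgt_emap, f.src_emap, f.label_emap, f.map_finish, f.map_start⟩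

theorem HomEquiv.rev {X Y : SigmaTree A} (h : HomEquiv X Y) : HomEquiv X.rev Y.rev :=
  ⟨h.1.map Hom.rev, h.2.map Hom.rev⟩

theorem IsRightAdequate.rev {X : SigmaTree A} (h : X.IsRightAdequate) : X.rev.IsLeftAdequate :=
  fun x => LDigraph.Reach.rev (h x)

theorem IsLeftAdequate.rev {X : SigmaTree A} (h : X.IsLeftAdequate) : X.rev.IsRightAdequate :=
  fun x => LDigraph.Reach.rev (h x)

/-- A morphism into a reversed digraph, as a morphism out of the reversed digraph. -/
def revG {D D' : LDigraph A} (f : GHom D D'.rev) : GHom D.rev D' :=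
  ⟨f.vmap, f.emap, f.tgt_emap, f.src_emap, f.label_emap⟩

theorem homEquiv_rev_umul (X Y : SigmaTree A) :
    HomEquiv (umul X Y).rev (umul Y.rev X.rev) := by
  have h1 : ∀ X Y : SigmaTree A, Nonempty (Hom (umul Y.rev X.rev) (umul X Y).rev) := fun X Y =>
    nonempty_hom_umul.2 ⟨Sum.inl X.finish, ⟨revG (D' := (umul X Y).rev.toLDigraph) (inrG X Y), rfl,
      glue_start X Y⟩, revG (D' := (umul X Y).rev.toLDigraph) (inlG X Y), rfl, rfl⟩
  exact ⟨(h1 Y.rev X.rev).map Hom.rev, h1 X Y⟩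

theorem homEquiv_base_rev (a : A) : HomEquiv (base a).rev (base a) :=
  ⟨⟨⟨not, fun _ => (), fun _ => rfl, fun _ => rfl, fun _ => rfl, rfl, rfl⟩⟩,
    ⟨⟨not, fun _ => (), fun _ => rfl, fun _ => rfl, fun _ => rfl, rfl, rfl⟩⟩⟩

end SigmaTree

namespace RT

variable {A : Type u}

/-- The isomorphism type of the pruning of a right adequate tree. -/
noncomputable def ofTree {X : SigmaTree A} (hX : X.IsRightAdequate) : RT A :=
  ⟨⟨Quotient.mk _ (pruneRep X), pruneRep_isPruned X⟩, SigmaTree.IsRightAdequate.pruneRep hX⟩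

theorem ofTree_eq_iff {X Y : SigmaTree A} {hX : X.IsRightAdequate} {hY : Y.IsRightAdequate} :
    ofTree hX = ofTree hY ↔ HomEquiv X Y := by
  rw [← iso_pruneRep_iff]
  exact Subtype.ext_iff.trans (Subtype.ext_iff.trans Quotient.eq)

theorem eq_ofTree {X : SigmaTree A} (hX : X.IsRightAdequate) (pX : X.IsPruned) :
    (⟨⟨Quotient.mk _ X, pX⟩, hX⟩ : RT A) = ofTree hX :=
  Subtype.ext (Subtype.ext (Quotient.sound
    (pX.iso_of_homEquiv (pruneRep_isPruned X) (homEquiv_pruneRep X).symm)))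

theorem exists_eq_ofTree (x : RT A) :
    ∃ (X : SigmaTree A) (hX : X.IsRightAdequate), x = ofTree hX := by
  obtain ⟨⟨⟨X⟩, pX⟩, hX⟩ := x
  exact ⟨X, hX, eq_ofTree hX pX⟩

theorem base_isRightAdequate (a : A) : (SigmaTree.base a).IsRightAdequate := (RT.base a).2

theorem trivial_isRightAdequate : (trivial A).IsRightAdequate := (1 : RT A).2

theorem one_eq : (1 : RT A) = ofTree trivial_isRightAdequate := eq_ofTree _ _

theorem base_eq (a : A) : RT.base a = ofTree (base_isRightAdequate a) := eq_ofTree _ _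

theorem ofTree_mul {X Y : SigmaTree A} (hX : X.IsRightAdequate) (hY : Y.IsRightAdequate) :
    ofTree hX * ofTree hY = ofTree (hX.umul hY) := by
  change ofTree ((SigmaTree.IsRightAdequate.pruneRep hX).umul
    (SigmaTree.IsRightAdequate.pruneRep hY)) = _
  exact ofTree_eq_iff.2 ((homEquiv_pruneRep X).umul (homEquiv_pruneRep Y))

theorem ustar_isRightAdequate {X : SigmaTree A} (hX : X.IsRightAdequate) :
    (ustar X).IsRightAdequate := hX

theorem un_ofTree {X : SigmaTree A} (hX : X.IsRightAdequate) :
    Alg210.un (ofTree hX) = ofTree (ustar_isRightAdequate hX) := by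
  change ofTree (ustar_isRightAdequate (SigmaTree.IsRightAdequate.pruneRep hX)) = _
  exact ofTree_eq_iff.2 (homEquiv_pruneRep X).rev.uplus.rev

/-- Reversal of trees, as a map from `RT¹(Σ)` to `LT¹(Σ)`. -/
noncomputable def rev (x : RT A) : LT A :=
  LT.ofTree (exists_eq_ofTree x).choose_spec.choose.rev

theorem rev_ofTree {X : SigmaTree A} (hX : X.IsRightAdequate) :
    rev (ofTree hX) = LT.ofTree hX.rev :=
  LT.ofTree_eq_iff.2
    (ofTree_eq_iff.1 (exists_eq_ofTree (ofTree hX)).choose_spec.choose_spec).symm.rev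

theorem rev_bijective : Function.Bijective (rev : RT A → LT A) := by
  constructor
  · intro x y h
    obtain ⟨X, hX, rfl⟩ := exists_eq_ofTree x
    obtain ⟨Y, hY, rfl⟩ := exists_eq_ofTree y
    rw [rev_ofTree, rev_ofTree, LT.ofTree_eq_iff] at h
    exact ofTree_eq_iff.2 h.rev
  · intro x
    obtain ⟨X, hX, rfl⟩ := LT.exists_eq_ofTree x
    exact ⟨ofTree hX.rev, rev_ofTree _⟩

theorem rev_mul (x y : RT A) : rev (x * y) = rev y * rev x := by
  obtain ⟨X, hX, rfl⟩ := exists_eq_ofTree x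
  obtain ⟨Y, hY, rfl⟩ := exists_eq_ofTree y
  rw [ofTree_mul, rev_ofTree, rev_ofTree, rev_ofTree, LT.ofTree_mul]
  exact LT.ofTree_eq_iff.2 (homEquiv_rev_umul X Y)

theorem rev_un (x : RT A) : rev (Alg210.un x) = Alg210.un (rev x) := by
  obtain ⟨X, hX, rfl⟩ := exists_eq_ofTree x
  rw [un_ofTree, rev_ofTree, rev_ofTree, LT.un_ofTree]
  rfl

theorem rev_one : rev (1 : RT A) = 1 := by
  rw [one_eq, rev_ofTree, LT.one_eq, LT.ofTree_eq_iff]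
  exact ⟨⟨⟨fun x => x, fun e => e, fun e => e.elim, fun e => e.elim, fun e => e.elim, rfl, rfl⟩⟩,
    ⟨⟨fun x => x, fun e => e, fun e => e.elim, fun e => e.elim, fun e => e.elim, rfl, rfl⟩⟩⟩

theorem rev_base (a : A) : rev (RT.base a) = LT.base a := by
  rw [base_eq, rev_ofTree, LT.base_eq, LT.ofTree_eq_iff]
  exact homEquiv_base_rev a

end RT

/-! ### Transfer of freeness along an anti-isomorphism -/

/-- The opposite multiplication, with the same unary operation. -/
instance {M : Type u} [Alg210 M] : Alg210 Mᵐᵒᵖ where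
  un x := MulOpposite.op (Alg210.un x.unop)

theorem IsRightAdequateMonoid.op {M : Type u} [Alg210 M] (h : IsRightAdequateMonoid M) :
    IsLeftAdequateMonoid Mᵐᵒᵖ where
  mul_assoc x y z := MulOpposite.unop_injective (h.mul_assoc z.unop y.unop x.unop).symm
  one_mul x := MulOpposite.unop_injective (h.mul_one x.unop)
  mul_one x := MulOpposite.unop_injective (h.one_mul x.unop)
  idem_comm e f he hf := MulOpposite.unop_injective
    (h.idem_comm f.unop e.unop (congrArg MulOpposite.unop hf) (congrArg MulOpposite.unop he))
  un_idem x := MulOpposite.unop_injective (h.un_idem x.unop)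
  un_rel x y z := MulOpposite.unop_injective.eq_iff.symm.trans
    ((h.un_rel x.unop y.unop z.unop).trans MulOpposite.unop_injective.eq_iff)

section Transfer

variable {F : Type u} {G : Type v} [Alg210 F] [Alg210 G] {φ : G → F}

theorem IsLeftAdequateMonoid.of_antiIso (hF : IsLeftAdequateMonoid F) (hφ : Function.Injective φ)
    (h_mul : ∀ x y, φ (x * y) = φ y * φ x) (h_one : φ 1 = 1)
    (h_un : ∀ x, φ (Alg210.un x) = Alg210.un (φ x)) : IsRightAdequateMonoid G where
  mul_assoc x y z := hφ (by simp only [h_mul, hF.mul_assoc])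
  one_mul x := hφ (by rw [h_mul, h_one, hF.mul_one])
  mul_one x := hφ (by rw [h_mul, h_one, hF.one_mul])
  idem_comm e f he hf := hφ (by
    have he' : IsIdempotentElem (φ e) := (h_mul e e).symm.trans (congrArg φ he)
    have hf' : IsIdempotentElem (φ f) := (h_mul f f).symm.trans (congrArg φ hf)
    rw [h_mul, h_mul, hF.idem_comm _ _ hf' he'])
  un_idem x := hφ (by rw [h_mul, h_un]; exact hF.un_idem (φ x))
  un_rel x y z := by
    rw [← hφ.eq_iff, h_mul, h_mul, hF.un_rel (φ x) (φ y) (φ z), ← h_un, ← h_mul, ← h_mul,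
      hφ.eq_iff]

theorem IsFreeLeftAdequateMonoidOn.of_antiIso {S : Set F} {T : Set G}
    (hF : IsFreeLeftAdequateMonoidOn.{u, w} F S) (hφ : Function.Bijective φ)
    (h_mul : ∀ x y, φ (x * y) = φ y * φ x) (h_one : φ 1 = 1)
    (h_un : ∀ x, φ (Alg210.un x) = Alg210.un (φ x)) (hT : ∀ x, x ∈ T ↔ φ x ∈ S) :
    IsFreeRightAdequateMonoidOn.{v, w} G T where
  mem := hF.mem.of_antiIso hφ.1 h_mul h_one h_un
  exists_unique_extension M _ hM χ := by
    obtain ⟨ψ, hψ1, hψ2⟩ := Function.bijective_iff_has_inverse.1 hφ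
    have hS : ∀ s : S, ψ s ∈ T := fun s => (hT _).2 (by rw [hψ2]; exact s.2)
    obtain ⟨f, ⟨hf, hfχ⟩, huniq⟩ := hF.exists_unique_extension Mᵐᵒᵖ hM.op
      fun s => MulOpposite.op (χ ⟨ψ s, hS s⟩)
    refine ⟨fun x => (f (φ x)).unop, ⟨⟨fun x y => ?_, ?_, fun x => ?_⟩, fun t => ?_⟩, ?_⟩
    · rw [h_mul, hf.map_mul]; rfl
    · rw [h_one, hf.map_one]; rfl
    · rw [h_un, hf.map_un]; rfl
    · have := hfχ ⟨φ t, (hT t).1 t.2⟩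
      dsimp only at this ⊢
      rw [this, MulOpposite.unop_op]
      exact congrArg χ (Subtype.ext (hψ1 t))
    · rintro g ⟨hg, hgχ⟩
      have := huniq (fun x => MulOpposite.op (g (ψ x))) ⟨⟨fun x y => ?_, ?_, fun x => ?_⟩,
        fun s => ?_⟩
      · funext x
        rw [← this]
        exact congrArg g (hψ1 x).symm
      · have : ψ (x * y) = ψ y * ψ x := hφ.1 (by rw [hψ2, h_mul, hψ2, hψ2])
        rw [this, hg.map_mul]; rfl
      · have : ψ 1 = 1 := hφ.1 (by rw [hψ2, h_one])
        rw [this, hg.map_one]; rfl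
      · have : ψ (Alg210.un x) = Alg210.un (ψ x) := hφ.1 (by rw [hψ2, h_un, hψ2])
        rw [this, hg.map_un]; rfl
      · exact congrArg MulOpposite.op (hgχ ⟨ψ s, hS s⟩)

end Transfer

theorem RT.isFreeRightAdequateMonoidOn (A : Type u) :
    IsFreeRightAdequateMonoidOn.{max 1 u, w} (RT A) (Set.range RT.base) := by
  refine (LT.isFreeLeftAdequateMonoidOn A).of_antiIso RT.rev_bijective RT.rev_mul RT.rev_one
    RT.rev_un fun x => ⟨?_, ?_⟩
  · rintro ⟨a, rfl⟩
    exact ⟨a, (RT.rev_base a).symm⟩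
  · rintro ⟨a, ha⟩
    exact ⟨a, RT.rev_bijective.1 ((RT.rev_base a).trans ha)⟩

theorem RT.base_injective (A : Type u) : Function.Injective (RT.base : A → RT A) := fun a b h =>
  LT.base_injective (by rw [← RT.rev_base, ← RT.rev_base, h])

end AdequateTrees

theorem mainTheorem1 (A : Type u) :
    (Function.Injective (AdequateTrees.LT.base : A → AdequateTrees.LT A) ∧
      AdequateTrees.IsFreeLeftAdequateMonoidOn.{max 1 u, w} (AdequateTrees.LT A)
        (Set.range AdequateTrees.LT.base)) ∧
    (Function.Injective (AdequateTrees.RT.base : A → AdequateTrees.RT A) ∧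
      AdequateTrees.IsFreeRightAdequateMonoidOn.{max 1 u, w} (AdequateTrees.RT A)
        (Set.range AdequateTrees.RT.base)) :=
  ⟨⟨AdequateTrees.LT.base_injective, AdequateTrees.LT.isFreeLeftAdequateMonoidOn A⟩,
    AdequateTrees.RT.base_injective A, AdequateTrees.RT.isFreeRightAdequateMonoidOn A⟩
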